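/- Fix an integer $m\ge 0$ and an erasure probability $\epsilon\in[0,1]$. Consider a sequence, indexed by $t\in\mathbb N$ (an index suppressed below), of retrieval problems of the following form. There is a vocabulary $[N]=\{1,\dots,N\}$, a query $q=(w_1,\dots,w_L)\in[N]^L$, a set $\mathcal L_s\subseteq[N]$ of stop words, $n=m+1$ documents with term-frequency vectors $\mathbf v_{d_1},\dots,\mathbf v_{d_n}\in\mathbb R^N$ (not necessarily normalized; term $i$ occurs in document $d_j$ iff $v_{d_j,i}\ne0$), a ground-truth document $k$ (any of the $n$), and a design rate $R>0$. Put - $v_{q,i}=0$ if $i\in\mathcal L_s$ and $v_{q,i}=\frac1L|\{l:w_l=i\}|$ otherwise; $\mathcal S_q=\{i:v_{q,i}\neq0\}$, $K_q=|\mathcal S_q|$; $M=|\{l: w_l\notin\mathcal L_s\}|$; - $r_i=\Big\lceil \frac{M}{R\sum_j v_{q,j}}v_{q,i}\Big\rceil$ and $p_i=1-\epsilon^{r_i}$; - $\zeta_i=\log\frac{n+1}{n_i+1}$, where $n_i$ is the number of documents that contain term $i$. Conditionally on $\mathbf v_q$, the erasure indicators $e_1,\dots,e_N\in\{0,1\}$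 are independent with $\Pr(e_i=1)=p_i$. The received vector is $\hat v_{q,i}=v_{q,i}e_i$, the scores are $\hat s_j=\sum_{i\in\mathcal S_q}\zeta_i^2(\hat v_{q,i}-v_{d_j,i})^2$ for $j=1,\dots,n$, and the retrieved index $\hat k$ is a minimizer of $j\mapsto\hat s_j$, with ties broken in any (possibly randomized) way. Let $P_e(\mathbf v_q)=\Pr(\hat k\ne k\mid\mathbf v_q)$. Writing $\delta_{j,i}=2\zeta_i^2v_{q,i}(v_{d_k,i}-v_{d_j,i})$ and $C_{j,i}=\zeta_i^2(v_{d_j,i}^2-v_{d_k,i}^2)$ for $j\ne k$, and $\boldsymbol\delta_i=(\delta_{j,i})_{j\ne k}$, $\mathbf C_i=(C_{j,i})_{j\ne k}\in\mathbb R^m$ (with the competitors $j\neq k$ listed in increasing order), the margin vector $(\hat s_j-\hat s_k)_{j\ne k}=\sum_{i\in\mathcal S_q}(\mathbf C_i+e_i\boldsymbol\delta_i)$ has mean and covariance $$\boldsymbol\mu(\mathbf v_q)=\sum_{i\in\mathcal S_q}(\mathbf C_i+p_i\boldsymbol\delta_i),\qquad \boldsymbol\Sigma(\mathbf v_q)=\sum_{i\in\mathcal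 S_q}p_i(1-p_i)\boldsymbol\delta_i\boldsymbol\delta_i^\top .$$ Let $\mathbf Y_i=(e_i-p_i)\boldsymbol\delta_i$. The *directional Lindeberg condition* says that for every fixed unit vector $\mathbf u\in\mathbb R^m$ and every $\eta>0$, along the sequence, $$\frac1{\mathbf u^\top\boldsymbol\Sigma(\mathbf v_q)\mathbf u}\sum_{i\in\mathcal S_q}\mathbb E\Big[(\mathbf u^\top\mathbf Y_i)^2\,\mathbf 1\big\{|\mathbf u^\top\mathbf Y_i|>\eta\sqrt{\mathbf u^\top\boldsymbol\Sigma(\mathbf v_q)\mathbf u}\big\}\,\Big|\,\mathbf v_q\Big]\to0,$$ where the ratio is read as $0$ if $\mathbf u^\top\boldsymbol\Sigma(\mathbf v_q)\mathbf u=0$. Let $\Phi_m(\mathbf x;\mathbf a,\mathbf A)=\Pr(Z_j\le x_j\ \forall j)$ for $Z\sim\mathcal N(\mathbf a,\mathbf A)$. **Theorem 1.** Assume that $K_q\to\infty$ along the sequence. (a) Let $0<\epsilon<1$, let $r_0\ge1$ be a fixed integer, and let $G=\{i\in\mathcal S_q:r_i\le r_0\}$, $B=\mathcal S_q\setminus G$.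 Suppose that: (A1) there are constants $0<c_1\le c_2$ with $c_1/L\le v_{q,i}\le c_2/L$ for all $i\in G$ and all large $t$, and $|G|\to\infty$; (A2) there are constants $C_d,C_\zeta$ with $|v_{d_k,i}-v_{d_j,i}|\le C_d$ and $\zeta_i\le C_\zeta$ for all $t$, $i\in\mathcal S_q$, $j\ne k$; (A3) for every unit vector $\mathbf u\in\mathbb R^m$ there is $c_{\mathbf u}>0$ with $\sum_{i\in G}(\mathbf u^\top\boldsymbol\delta_i)^2\ge c_{\mathbf u}\sum_{i\in G}v_{q,i}^2$ for all large $t$; (A4) $\sum_{i\in B}v_{q,i}^2\big/\sum_{i\in G}v_{q,i}^2\to0$. Then the directional Lindeberg condition holds. (b) Suppose that the directional Lindeberg condition holds and that the probability that $\mathcal N(\boldsymbol\mu(\mathbf v_q),\boldsymbol\Sigma(\mathbf v_q))$ assigns to the boundary of the positive orthant $\{x\in\mathbb R^m:x_j>0\ \forall j\}$ tends to $0$ along the sequence (for instance, is $0$ for every $t$). Then $$P_e(\mathbf v_q)-\big[1-\Phi_m(\mathbf 0;-\boldsymbol\mu(\mathbf v_q),\boldsymbol\Sigma(\mathbf v_q))\big]\to0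 .$$ -/

import Mathlib

open MeasureTheory ProbabilityTheory Filter Topology

noncomputable section

/-- One TF-IDF retrieval problem with `m + 1` documents (hence `m` competitors of the ground-truth
document), over a vocabulary of `N` terms. The query is a word of length `L` over the vocabulary.
A term occurs in a document iff the corresponding coordinate of its term-frequency vector is
nonzero; no particular normalization of the document vectors is imposed. -/
structure RetrievalProblem (m : ℕ) where
  /-- vocabulary size -/
  N : ℕ
  /-- query length -/
  L : ℕ
  /-- the query, a sequence of terms -/
  query : Fin L → Fin N
  /-- stop-word index set -/
  stopWords : Finset (Fin N)
  /-- term-frequency vectors of the documents -/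
  doc : Fin (m + 1) → Fin N → ℝ
  /-- the ground-truth document -/
  k : Fin (m + 1)
  /-- design rate -/
  R : ℝ
  R_pos : 0 < R

namespace RetrievalProblem

variable {m : ℕ} (I : RetrievalProblem m)

/-- Number of occurrences of term `i` in the query. -/
def count (i : Fin I.N) : ℕ := (Finset.univ.filter fun l => I.query l = i).card

/-- The stop-word-filtered normalized term-frequency vector of the query. -/
def v (i : Fin I.N) : ℝ := if i ∈ I.stopWords then 0 else (I.count i : ℝ) / (I.L : ℝ)

/-- The query support. -/
def S : Finset (Fin I.N) := Finset.univ.filter fun i => I.v i ≠ 0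

/-- The query support size. -/
def K : ℕ := I.S.card

/-- Number of query tokens that remain after stop-word removal. -/
def M : ℕ := (Finset.univ.filter fun l => I.query l ∉ I.stopWords).card

/-- Number of repetitions of the pair `(i, v i)`. -/
def r (i : Fin I.N) : ℕ := ⌈(I.M : ℝ) / (I.R * ∑ j, I.v j) * I.v i⌉₊

/-- Survival probability of coordinate `i` for the erasure probability `ε`. -/
def p (ε : ℝ) (i : Fin I.N) : ℝ := 1 - ε ^ I.r i

/-- Number of documents that contain term `i`. -/
def docFreq (i : Fin I.N) : ℕ := (Finset.univ.filter fun j => I.doc j i ≠ 0).card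

/-- Inverse document frequency of term `i`; the number of documents is `m + 1`. -/
def ζ (i : Fin I.N) : ℝ := Real.log (((m + 1 : ℕ) + 1 : ℝ) / ((I.docFreq i : ℝ) + 1))

/-- TF-IDF-weighted squared distance, over the query support, between a received query
vector `x` and document `j`. -/
def score (x : Fin I.N → ℝ) (j : Fin (m + 1)) : ℝ :=
  ∑ i ∈ I.S, I.ζ i ^ 2 * (x i - I.doc j i) ^ 2

/-- The index of the `j`-th competitor: `j ↦ I.k.succAbove j` enumerates the documents
other than `I.k`. -/
def comp (j : Fin m) : Fin (m + 1) := I.k.succAbove j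

/-- Baseline contribution of coordinate `i` to the margins. -/
def C (i : Fin I.N) : EuclideanSpace ℝ (Fin m) :=
  WithLp.toLp 2 fun j => I.ζ i ^ 2 * (I.doc (I.comp j) i ^ 2 - I.doc I.k i ^ 2)

/-- Transmission-dependent contribution of coordinate `i` to the margins. -/
def δ (i : Fin I.N) : EuclideanSpace ℝ (Fin m) :=
  WithLp.toLp 2 fun j => 2 * I.ζ i ^ 2 * I.v i * (I.doc I.k i - I.doc (I.comp j) i)

/-- The mean of the margin vector. -/
def μ (ε : ℝ) : EuclideanSpace ℝ (Fin m) := ∑ i ∈ I.S, (I.C i + I.p ε i • I.δ i)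

/-- The covariance matrix of the margin vector. -/
def covMat (ε : ℝ) : Matrix (Fin m) (Fin m) ℝ :=
  ∑ i ∈ I.S, (I.p ε i * (1 - I.p ε i)) • Matrix.vecMulVec (I.δ i).ofLp (I.δ i).ofLp

/-- The directional variance `uᵀ Σ u`. -/
def dirVar (ε : ℝ) (u : EuclideanSpace ℝ (Fin m)) : ℝ :=
  dotProduct u.ofLp ((I.covMat ε).mulVec u.ofLp)

/-- The coordinates with at most `r₀` repetitions. -/
def good (r₀ : ℕ) : Finset (Fin I.N) := I.S.filter fun i => I.r i ≤ r₀

/-- The coordinates with more than `r₀` repetitions. -/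
def bad (r₀ : ℕ) : Finset (Fin I.N) := I.S.filter fun i => r₀ < I.r i

/-- `e` is a vector of independent erasure indicators: `e i = 1` with probability `1 - ε ^ r i`
and `e i = 0` with probability `ε ^ r i`. -/
structure IsErasure (ε : ℝ) {Ω : Type*} [MeasurableSpace Ω] (P : Measure Ω)
    (e : Fin I.N → Ω → ℝ) : Prop where
  measurable : ∀ i, Measurable (e i)
  indep : iIndepFun e P
  prob_one : ∀ i, P.real {ω | e i ω = 1} = 1 - ε ^ I.r i
  prob_zero : ∀ i, P.real {ω | e i ω = 0} = ε ^ I.r i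

/-- The received query vector `v ∘ e`. -/
def received {Ω : Type*} (e : Fin I.N → Ω → ℝ) (ω : Ω) (i : Fin I.N) : ℝ := I.v i * e i ω

/-- `khat` is the outcome of the minimum-distance rule: it minimizes the score. Ties may be broken
in any way, with or without extra randomness. -/
structure IsDecision {Ω : Type*} [MeasurableSpace Ω] (P : Measure Ω)
    (e : Fin I.N → Ω → ℝ) (khat : Ω → Fin (m + 1)) : Prop where
  measurable : Measurable khat
  minimizes : ∀ᵐ ω ∂P, ∀ j, I.score (I.received e ω) (khat ω) ≤ I.score (I.received e ω) j

/-- The error probability of the decision `khat`. -/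
def errorProb {Ω : Type*} [MeasurableSpace Ω] (P : Measure Ω) (khat : Ω → Fin (m + 1)) : ℝ :=
  P.real {ω | khat ω ≠ I.k}

/-- The centered contribution of coordinate `i` to the margin vector. -/
def Y (ε : ℝ) {Ω : Type*} (e : Fin I.N → Ω → ℝ) (i : Fin I.N) (ω : Ω) :
    EuclideanSpace ℝ (Fin m) := (e i ω - I.p ε i) • I.δ i

/-- The Lindeberg ratio in direction `u` at level `η` (equal to `0` if the directional variance
vanishes). -/
def lindebergRatio (ε : ℝ) {Ω : Type*} [MeasurableSpace Ω] (P : Measure Ω)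
    (e : Fin I.N → Ω → ℝ) (u : EuclideanSpace ℝ (Fin m)) (η : ℝ) : ℝ :=
  (∑ i ∈ I.S, ∫ ω, Set.indicator
      {ω | η * √(I.dirVar ε u) < |inner ℝ u (I.Y ε e i ω)|}
      (fun ω => inner ℝ u (I.Y ε e i ω) ^ 2) ω ∂P) / I.dirVar ε u

end RetrievalProblem

/-- The directional Lindeberg condition along a sequence of problems. -/
def DirectionalLindeberg {m : ℕ} (ε : ℝ) (I : ℕ → RetrievalProblem m) {Ω : ℕ → Type*}
    [∀ t, MeasurableSpace (Ω t)] (P : ∀ t, Measure (Ω t))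
    (e : ∀ t, Fin (I t).N → Ω t → ℝ) : Prop :=
  ∀ u : EuclideanSpace ℝ (Fin m), ‖u‖ = 1 → ∀ η : ℝ, 0 < η →
    Tendsto (fun t => (I t).lindebergRatio ε (P t) (e t) u η) atTop (𝓝 0)

/-- Regularity conditions on a sequence of problems, for a fixed threshold `r₀` that separates
coordinates with few repetitions from coordinates with many. -/
structure Regularity {m : ℕ} (r₀ : ℕ) (I : ℕ → RetrievalProblem m) : Prop where
  /-- on the coordinates with few repetitions, the weights are of order `1 / L` -/
  singleton : ∃ c₁ c₂ : ℝ, 0 < c₁ ∧ c₁ ≤ c₂ ∧ ∀ᶠ t in atTop, ∀ i ∈ (I t).good r₀,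
    c₁ / ((I t).L : ℝ) ≤ (I t).v i ∧ (I t).v i ≤ c₂ / ((I t).L : ℝ)
  /-- the number of these coordinates tends to infinity -/
  card_good : Tendsto (fun t => ((I t).good r₀).card) atTop atTop
  /-- document differences and IDF weights are uniformly bounded -/
  bounded : ∃ Cd Cζ : ℝ, ∀ t, ∀ i ∈ (I t).S,
    (∀ j, |(I t).doc (I t).k i - (I t).doc ((I t).comp j) i| ≤ Cd) ∧ (I t).ζ i ≤ Cζ
  /-- directional non-degeneracy -/
  nondegenerate : ∀ u : EuclideanSpace ℝ (Fin m), ‖u‖ = 1 → ∃ c : ℝ, 0 < c ∧ ∀ᶠ t in atTop,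
    c * ∑ i ∈ (I t).good r₀, (I t).v i ^ 2 ≤ ∑ i ∈ (I t).good r₀, inner ℝ u ((I t).δ i) ^ 2
  /-- the coordinates with many repetitions carry a negligible part of the energy -/
  tail : Tendsto (fun t => (∑ i ∈ (I t).bad r₀, (I t).v i ^ 2) /
    ∑ i ∈ (I t).good r₀, (I t).v i ^ 2) atTop (𝓝 0)

/-- The open positive orthant of `ℝᵐ`. -/
def posOrthant (m : ℕ) : Set (EuclideanSpace ℝ (Fin m)) := {x | ∀ j, 0 < x j}

/-- The Gaussian distribution function `Φ_m(x; a, A)`: the probability that a Gaussian vector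
with mean `a` and covariance matrix `A` is coordinatewise at most `x`. -/
def gaussianCDF {m : ℕ} (x a : EuclideanSpace ℝ (Fin m)) (A : Matrix (Fin m) (Fin m) ℝ) : ℝ :=
  (multivariateGaussian a A).real {z | ∀ j, z j ≤ x j}

end

/-!
The margin vector is an affine image of independent Bernoulli variables, and retrieval succeeds when
it lies in the open positive orthant and fails when it lies outside the closed one. The error
probability is therefore governed by a multivariate central limit theorem, evaluated on an orthant.

*Sufficiency of the regularity conditions* (`RetrievalProblem.truncVar_div_le`,
`Regularity.directionalLindeberg`). On the coordinates with at most `r₀` repetitions the survival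
probabilities stay away from `0` and `1`, so the directional variance is at least a constant times
the energy `∑ v i ^ 2` of these coordinates. Each of them carries a fraction `O(1 / |G|)` of that
energy and so falls below the truncation level; the remaining coordinates carry a vanishing fraction
altogether.

*Gaussian approximation.* The matrices `Σ` may degenerate along the sequence, in directions that
vary with the problem, and the means may diverge. Orthants are invariant under positive scaling of
the coordinates, so coordinate `j` may be divided by `|μ j| + √Σ j j`. This has two effects. The
rescaled means and covariances stay in a compact set, and no Gaussian limit along a subsequence
charges a hyperplane `x j = 0`: a coordinate with zero limiting variance has limiting mean `1` or
`-1`. Hence Lévy's theorem and the portmanteau theorem apply along subsequences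
(`tendsto_measureReal_sub_multivariateGaussian`). Coordinates with zero mean and zero variance are
almost surely zero for the margins and for the Gaussian, and are shifted to `1` before the
comparison.

The convergence of the characteristic functions needs the Lindeberg condition in the rescaled
directions, which are not fixed. A truncated square of a sum of `m` terms is bounded by truncated
squares of the single terms, and coordinate `j` is scaled by at most the inverse of its standard
deviation, so the Lindeberg condition in the `m` coordinate directions suffices
(`RetrievalProblem.truncVar_coordAffine_le`). All expectations over a Bernoulli variable are
two-point sums, for which Lindeberg's estimate is elementary
(`norm_prod_centeredBernoulli_exp_sub_le`).

This gives the convergence of the probabilities of the closed orthant. Ties cost at most the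
probability that the margin vector lies on the boundary, which tends to zero with its Gaussian
counterpart (`tendsto_measureReal_nonnegOrthant_diff`).
-/

/-! ### Centred Bernoulli expectations and the Lindeberg bound -/

/-- The expectation of `f (b - p)` for a Bernoulli variable `b` with success probability `p`. -/
def centeredBernoulli {F : Type*} [AddCommGroup F] [Module ℝ F] (p : ℝ) (f : ℝ → F) : F :=
  p • f (1 - p) + (1 - p) • f (-p)

/-- The truncated square `y ↦ y² 1{η < |y|}` of Lindeberg's condition. -/
noncomputable def truncSq (η y : ℝ) : ℝ := if η < |y| then y ^ 2 else 0

lemma truncSq_nonneg (η y : ℝ) : 0 ≤ truncSq η y := by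
  unfold truncSq; split_ifs <;> positivity

lemma truncSq_le_sq (η y : ℝ) : truncSq η y ≤ y ^ 2 := by
  unfold truncSq; split_ifs
  · exact le_rfl
  · positivity

lemma sq_le_add_truncSq {η : ℝ} (y : ℝ) : y ^ 2 ≤ η ^ 2 + truncSq η y := by
  unfold truncSq; split_ifs with h
  · nlinarith [sq_nonneg η]
  · rw [add_zero, ← sq_abs y]
    exact pow_le_pow_left₀ (abs_nonneg _) (not_lt.1 h) 2

/-- If `|∑ z|` is large then so is the largest `|z j|`, up to the number of summands. -/
lemma truncSq_sum_le {m : ℕ} (η : ℝ) (z : Fin m → ℝ) :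
    truncSq η (∑ j, z j) ≤ (m : ℝ) ^ 2 * ∑ j, truncSq (η / m) (z j) := by
  have hsum : 0 ≤ ∑ j, truncSq (η / m) (z j) := Finset.sum_nonneg fun j _ => truncSq_nonneg _ _
  rcases Nat.eq_zero_or_pos m with rfl | hm
  · simp [truncSq]
  by_cases h : η < |∑ j, z j|
  swap
  · rw [truncSq, if_neg h]; positivity
  have hm' : (0 : ℝ) < m := by exact_mod_cast hm
  have : Nonempty (Fin m) := ⟨⟨0, hm⟩⟩
  obtain ⟨j, -, hj⟩ := Finset.exists_max_image Finset.univ (fun j => |z j|) Finset.univ_nonempty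
  have hle : |∑ j, z j| ≤ m * |z j| := by
    calc |∑ j, z j| ≤ ∑ j, |z j| := Finset.abs_sum_le_sum_abs _ _
      _ ≤ ∑ _i : Fin m, |z j| := Finset.sum_le_sum fun i hi => hj i hi
      _ = m * |z j| := by simp
  have hjη : η / m < |z j| := by
    rw [div_lt_iff₀ hm']; linarith
  calc truncSq η (∑ j, z j) = |∑ j, z j| ^ 2 := by rw [truncSq, if_pos h, sq_abs]
    _ ≤ (m * |z j|) ^ 2 := pow_le_pow_left₀ (abs_nonneg _) hle 2
    _ = m ^ 2 * truncSq (η / m) (z j) := by rw [truncSq, if_pos hjη, mul_pow, sq_abs]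
    _ ≤ m ^ 2 * ∑ j, truncSq (η / m) (z j) := by
      gcongr
      exact Finset.single_le_sum (f := fun j => truncSq (η / m) (z j))
        (fun j _ => truncSq_nonneg _ _) (Finset.mem_univ j)

/-- A truncated square after multiplication by `c`, where `c σ ≤ |s|`, is dominated by the
truncated square in units of `σ`. -/
lemma truncSq_mul_le {η σ c s : ℝ} (hσ : 0 < σ) (hc : |c| * σ ≤ |s|) (y : ℝ) :
    truncSq η (c * y) ≤ s ^ 2 / σ ^ 2 * truncSq (η / (|s| + 1) * σ) y := by
  by_cases h : η < |c * y|
  swap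
  · rw [truncSq, if_neg h]
    exact mul_nonneg (by positivity) (truncSq_nonneg _ _)
  have h1 : |c * y| * σ ≤ |s| * |y| := by
    rw [abs_mul]; nlinarith [mul_le_mul_of_nonneg_right hc (abs_nonneg y)]
  have hlt : η / (|s| + 1) * σ < |y| := by
    rw [div_mul_eq_mul_div, div_lt_iff₀ (by positivity)]
    nlinarith [abs_nonneg y, mul_lt_mul_of_pos_right h hσ]
  rw [truncSq, if_pos h, truncSq, if_pos hlt, div_mul_eq_mul_div, le_div_iff₀ (by positivity)]
  have := pow_le_pow_left₀ (by positivity) h1 2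
  rwa [mul_pow, mul_pow, sq_abs, sq_abs, sq_abs] at this

section centeredBernoulli

variable {p : ℝ}

lemma centeredBernoulli_mono (hp₀ : 0 ≤ p) (hp₁ : p ≤ 1) {f g : ℝ → ℝ} (h : ∀ x, f x ≤ g x) :
    centeredBernoulli p f ≤ centeredBernoulli p g := by
  simp only [centeredBernoulli, smul_eq_mul]
  have := sub_nonneg.2 hp₁
  gcongr <;> apply h

lemma centeredBernoulli_nonneg (hp₀ : 0 ≤ p) (hp₁ : p ≤ 1) {f : ℝ → ℝ} (h : ∀ x, 0 ≤ f x) :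
    0 ≤ centeredBernoulli p f := by
  simp only [centeredBernoulli, smul_eq_mul]
  have := sub_nonneg.2 hp₁
  have := h (1 - p)
  have := h (-p)
  positivity

lemma centeredBernoulli_add (f g : ℝ → ℝ) :
    centeredBernoulli p (fun x => f x + g x) = centeredBernoulli p f + centeredBernoulli p g := by
  simp only [centeredBernoulli, smul_eq_mul]; ring

lemma centeredBernoulli_const_mul (c : ℝ) (f : ℝ → ℝ) :
    centeredBernoulli p (fun x => c * f x) = c * centeredBernoulli p f := by
  simp only [centeredBernoulli, smul_eq_mul]; ring

lemma centeredBernoulli_sum {ι : Type*} (s : Finset ι) (f : ι → ℝ → ℝ) :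
    centeredBernoulli p (fun x => ∑ j ∈ s, f j x) = ∑ j ∈ s, centeredBernoulli p (f j) := by
  simp only [centeredBernoulli, smul_eq_mul, Finset.mul_sum, Finset.sum_add_distrib]

lemma centeredBernoulli_const (c : ℝ) : centeredBernoulli p (fun _ => c) = c := by
  simp only [centeredBernoulli, smul_eq_mul]; ring

lemma centeredBernoulli_sq (θ : ℝ) :
    centeredBernoulli p (fun x => (x * θ) ^ 2) = p * (1 - p) * θ ^ 2 := by
  simp only [centeredBernoulli, smul_eq_mul]; ring

lemma norm_centeredBernoulli_le (hp₀ : 0 ≤ p) (hp₁ : p ≤ 1) {f : ℝ → ℂ} {g : ℝ → ℝ}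
    (h : ∀ x, ‖f x‖ ≤ g x) : ‖centeredBernoulli p f‖ ≤ centeredBernoulli p g := by
  have hp₂ := sub_nonneg.2 hp₁
  refine (norm_add_le _ _).trans ?_
  rw [norm_smul, norm_smul, Real.norm_of_nonneg hp₀, Real.norm_of_nonneg hp₂]
  simp only [centeredBernoulli, smul_eq_mul]
  gcongr <;> apply h

/-- A centred Bernoulli variable has absolute value at most `1`, so that nothing survives a
truncation above the weight. -/
lemma centeredBernoulli_truncSq_eq_zero {η θ : ℝ} (hp₀ : 0 ≤ p) (hp₁ : p ≤ 1)
    (h : |θ| ≤ η) : centeredBernoulli p (fun x => truncSq η (x * θ)) = 0 := by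
  have key (x : ℝ) (hx : |x| ≤ 1) : truncSq η (x * θ) = 0 := by
    rw [truncSq, if_neg]
    rw [not_lt, abs_mul]
    exact (mul_le_of_le_one_left (abs_nonneg _) hx).trans h
  rw [centeredBernoulli, key _ (by rw [abs_le]; constructor <;> linarith),
    key _ (by rw [abs_le]; constructor <;> linarith), smul_zero, smul_zero, add_zero]

end centeredBernoulli

/-- Second order Taylor estimate of `exp (i y)`, cubic for small `|y|` and quadratic for large
`|y|`. -/
lemma norm_exp_mul_I_sub_taylor_le {η : ℝ} (hη₀ : 0 ≤ η) (hη₁ : η ≤ 1) (y : ℝ) :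
    ‖Complex.exp (y * Complex.I) - (1 + y * Complex.I - y ^ 2 / 2)‖
      ≤ η * y ^ 2 + 4 * truncSq η y := by
  have hsmall : |y| ≤ 1 →
      ‖Complex.exp (y * Complex.I) - (1 + y * Complex.I - y ^ 2 / 2)‖ ≤ |y| ^ 3 := by
    intro h
    have hn : ‖(y * Complex.I : ℂ)‖ = |y| := by simp
    have := Complex.exp_bound (x := y * Complex.I) (by rw [hn]; exact h) (n := 3) (by norm_num)
    rw [hn] at this
    have e1 : ∑ k ∈ Finset.range 3, (y * Complex.I : ℂ) ^ k / (k.factorial : ℂ)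
        = 1 + y * Complex.I - y ^ 2 / 2 := by
      simp [Finset.sum_range_succ, mul_pow, Nat.factorial]; ring
    rw [e1] at this
    refine this.trans ?_
    have h3 : 0 ≤ |y| ^ 3 := by positivity
    norm_num [Nat.factorial]
    nlinarith
  have hlarge : 1 < |y| →
      ‖Complex.exp (y * Complex.I) - (1 + y * Complex.I - y ^ 2 / 2)‖ ≤ 4 * y ^ 2 := by
    intro h
    calc ‖Complex.exp (y * Complex.I) - (1 + y * Complex.I - y ^ 2 / 2)‖
        ≤ ‖Complex.exp (y * Complex.I)‖ + (‖(1 : ℂ)‖ + ‖(y * Complex.I : ℂ)‖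
          + ‖((y : ℂ) ^ 2 / 2)‖) := by
          refine (norm_sub_le _ _).trans ?_
          gcongr
          exact (norm_sub_le _ _).trans (by gcongr; exact norm_add_le _ _)
      _ = 1 + (1 + |y| + y ^ 2 / 2) := by
          rw [Complex.norm_exp_ofReal_mul_I]; simp
      _ ≤ 4 * y ^ 2 := by rw [← sq_abs y]; nlinarith
  by_cases hy : η < |y|
  · rw [truncSq, if_pos hy]
    by_cases h1 : |y| ≤ 1
    · refine (hsmall h1).trans ?_
      rw [← sq_abs y]
      have : |y| ^ 3 ≤ |y| ^ 2 := pow_le_pow_of_le_one (abs_nonneg _) h1 (by norm_num)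
      nlinarith [mul_nonneg hη₀ (sq_nonneg |y|), sq_nonneg |y|]
    · refine (hlarge (not_le.1 h1)).trans ?_
      nlinarith [mul_nonneg hη₀ (sq_nonneg y)]
  · rw [truncSq, if_neg hy]
    push Not at hy
    refine (hsmall (hy.trans hη₁)).trans ?_
    rw [← sq_abs y]
    nlinarith [mul_le_mul_of_nonneg_right hy (sq_nonneg |y|)]

lemma abs_exp_neg_sub_le {x : ℝ} (hx : 0 ≤ x) : |Real.exp (-x) - (1 - x)| ≤ x ^ 2 := by
  by_cases h : x ≤ 1
  · have := Real.abs_exp_sub_one_sub_id_le (x := -x) (by rwa [abs_neg, abs_of_nonneg hx])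
    rwa [neg_sq, sub_sub, ← sub_eq_add_neg] at this
  · push Not at h
    rw [abs_le]
    have h1 := Real.exp_pos (-x)
    have h2 : Real.exp (-x) ≤ 1 := Real.exp_le_one_iff.2 (by linarith)
    constructor <;> nlinarith

/-- Lindeberg's estimate for one summand: the characteristic function of a centred Bernoulli
variable is close to that of the Gaussian variable of the same variance. -/
lemma norm_centeredBernoulli_exp_sub_le {p : ℝ} (hp₀ : 0 ≤ p) (hp₁ : p ≤ 1) {η : ℝ} (hη₀ : 0 ≤ η)
    (hη₁ : η ≤ 1) (θ : ℝ) :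
    ‖centeredBernoulli p (fun x => Complex.exp ((x * θ : ℝ) * Complex.I))
        - (Real.exp (-(p * (1 - p) * θ ^ 2 / 2)) : ℝ)‖
      ≤ 2 * η * (p * (1 - p) * θ ^ 2) + (4 + p * (1 - p) * θ ^ 2) *
        centeredBernoulli p (fun x => truncSq η (x * θ)) := by
  set s := p * (1 - p) * θ ^ 2 with hs
  set T := centeredBernoulli p (fun x => truncSq η (x * θ)) with hT
  have hs0 : 0 ≤ s := by have := sub_nonneg.2 hp₁; positivity
  have hT0 : 0 ≤ T := centeredBernoulli_nonneg hp₀ hp₁ fun x => truncSq_nonneg _ _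
  have hsT : s ≤ η ^ 2 + T := by
    rw [hs, ← centeredBernoulli_sq, hT]
    calc _ ≤ centeredBernoulli p (fun x => η ^ 2 + truncSq η (x * θ)) :=
          centeredBernoulli_mono hp₀ hp₁ fun x => sq_le_add_truncSq _
      _ = _ := by rw [centeredBernoulli_add, centeredBernoulli_const]
  have h1 : ‖centeredBernoulli p (fun x => Complex.exp ((x * θ : ℝ) * Complex.I))
      - (1 - s / 2 : ℝ)‖ ≤ η * s + 4 * T := by
    have e : centeredBernoulli p (fun x => Complex.exp ((x * θ : ℝ) * Complex.I))
      - (1 - s / 2 : ℝ) = centeredBernoulli p (fun x => Complex.exp ((x * θ : ℝ) * Complex.I)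
        - (1 + (x * θ : ℝ) * Complex.I - (x * θ : ℝ) ^ 2 / 2)) := by
      simp only [centeredBernoulli, hs, Complex.real_smul]
      push_cast
      ring
    rw [e]
    refine (norm_centeredBernoulli_le hp₀ hp₁
      fun x => norm_exp_mul_I_sub_taylor_le hη₀ hη₁ (x * θ)).trans_eq ?_
    rw [centeredBernoulli_add, centeredBernoulli_const_mul, centeredBernoulli_const_mul,
      centeredBernoulli_sq]
  have h2 : ‖(Real.exp (-(s / 2)) : ℂ) - (1 - s / 2 : ℝ)‖ ≤ (s / 2) ^ 2 := by
    rw [← Complex.ofReal_sub, Complex.norm_real]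
    exact abs_exp_neg_sub_le (by positivity)
  have h3 : (s / 2) ^ 2 ≤ η * s + s * T := by
    have : s * s ≤ s * (η ^ 2 + T) := by gcongr
    have : η ^ 2 * s ≤ η * s := by gcongr; nlinarith
    nlinarith
  calc _ ≤ ‖centeredBernoulli p (fun x => Complex.exp ((x * θ : ℝ) * Complex.I))
      - (1 - s / 2 : ℝ)‖ + ‖(Real.exp (-(s / 2)) : ℂ) - (1 - s / 2 : ℝ)‖ := by
        rw [norm_sub_rev (Real.exp (-(s / 2)) : ℂ)]
        exact norm_sub_le_norm_sub_add_norm_sub _ _ _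
    _ ≤ _ := by nlinarith

lemma norm_prod_sub_prod_le {ι : Type*} (s : Finset ι) (f g : ι → ℂ) (hf : ∀ i ∈ s, ‖f i‖ ≤ 1)
    (hg : ∀ i ∈ s, ‖g i‖ ≤ 1) : ‖∏ i ∈ s, f i - ∏ i ∈ s, g i‖ ≤ ∑ i ∈ s, ‖f i - g i‖ := by
  classical
  induction s using Finset.induction_on with
  | empty => simp
  | insert a s ha ih =>
    rw [Finset.prod_insert ha, Finset.prod_insert ha, Finset.sum_insert ha]
    have hf' : ‖∏ i ∈ s, f i‖ ≤ 1 := by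
      rw [norm_prod]
      exact Finset.prod_le_one (fun _ _ => norm_nonneg _)
        fun i hi => hf i (Finset.mem_insert_of_mem hi)
    have e : f a * ∏ i ∈ s, f i - g a * ∏ i ∈ s, g i =
        (f a - g a) * ∏ i ∈ s, f i + g a * (∏ i ∈ s, f i - ∏ i ∈ s, g i) := by ring
    rw [e]
    refine (norm_add_le _ _).trans ?_
    rw [norm_mul, norm_mul]
    refine add_le_add (mul_le_of_le_one_right (norm_nonneg _) hf') ?_
    refine (mul_le_of_le_one_left (norm_nonneg _) (hg a (Finset.mem_insert_self _ _))).trans ?_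
    exact ih (fun i hi => hf i (Finset.mem_insert_of_mem hi))
      fun i hi => hg i (Finset.mem_insert_of_mem hi)

/-- Lindeberg's estimate for the characteristic function of a weighted sum of independent centred
Bernoulli variables. -/
lemma norm_prod_centeredBernoulli_exp_sub_le {ι : Type*} (S : Finset ι) {p θ : ι → ℝ}
    (hp₀ : ∀ i, 0 ≤ p i) (hp₁ : ∀ i, p i ≤ 1) {η : ℝ} (hη₀ : 0 ≤ η) (hη₁ : η ≤ 1) {B : ℝ}
    (hB : ∑ i ∈ S, p i * (1 - p i) * θ i ^ 2 ≤ B) :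
    ‖∏ i ∈ S, centeredBernoulli (p i) (fun x => Complex.exp ((x * θ i : ℝ) * Complex.I))
        - (Real.exp (-((∑ i ∈ S, p i * (1 - p i) * θ i ^ 2) / 2)) : ℝ)‖
      ≤ 2 * η * B + (4 + B) *
        ∑ i ∈ S, centeredBernoulli (p i) (fun x => truncSq η (x * θ i)) := by
  have hs0 : ∀ i, 0 ≤ p i * (1 - p i) * θ i ^ 2 := fun i => by
    have := sub_nonneg.2 (hp₁ i); have := hp₀ i; positivity
  have hT0 : ∀ i, 0 ≤ centeredBernoulli (p i) (fun x => truncSq η (x * θ i)) := fun i =>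
    centeredBernoulli_nonneg (hp₀ i) (hp₁ i) fun x => truncSq_nonneg _ _
  have e : (Real.exp (-((∑ i ∈ S, p i * (1 - p i) * θ i ^ 2) / 2)) : ℂ)
      = ∏ i ∈ S, (Real.exp (-(p i * (1 - p i) * θ i ^ 2 / 2)) : ℂ) := by
    rw [← Complex.ofReal_prod, ← Real.exp_sum, Finset.sum_neg_distrib, Finset.sum_div]
  rw [e]
  refine (norm_prod_sub_prod_le _ _ _ (fun i _ => ?_) fun i _ => ?_).trans ?_
  · refine (norm_centeredBernoulli_le (hp₀ i) (hp₁ i) (g := fun _ => 1) fun x => ?_).trans_eq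
      (centeredBernoulli_const 1)
    rw [Complex.norm_exp_ofReal_mul_I]
  · rw [Complex.norm_real, Real.norm_of_nonneg (Real.exp_pos _).le]
    exact Real.exp_le_one_iff.2 (by have := hs0 i; linarith)
  · calc _ ≤ ∑ i ∈ S, (2 * η * (p i * (1 - p i) * θ i ^ 2) + (4 + B) *
          centeredBernoulli (p i) (fun x => truncSq η (x * θ i))) := by
          refine Finset.sum_le_sum fun i hi => ?_
          refine (norm_centeredBernoulli_exp_sub_le (hp₀ i) (hp₁ i) hη₀ hη₁ (θ i)).trans ?_
          gcongr
          · exact hT0 i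
          · exact (Finset.single_le_sum (f := fun i => p i * (1 - p i) * θ i ^ 2)
              (fun i _ => hs0 i) hi).trans hB
      _ = 2 * η * ∑ i ∈ S, (p i * (1 - p i) * θ i ^ 2) + (4 + B) *
          ∑ i ∈ S, centeredBernoulli (p i) (fun x => truncSq η (x * θ i)) := by
          rw [Finset.sum_add_distrib, Finset.mul_sum, Finset.mul_sum]
      _ ≤ _ := by gcongr

/-! ### Orthants and Gaussian measures -/

/-- The closed nonnegative orthant of `ℝᵐ`. -/
def nonnegOrthant (m : ℕ) : Set (EuclideanSpace ℝ (Fin m)) := {x | ∀ j, 0 ≤ x j}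

lemma isClosed_nonnegOrthant (m : ℕ) : IsClosed (nonnegOrthant m) := by
  simp only [nonnegOrthant, Set.ofPred_forall]
  exact isClosed_iInter fun j => isClosed_le (by fun_prop) (by fun_prop)

lemma isOpen_posOrthant (m : ℕ) : IsOpen (posOrthant m) := by
  simp only [posOrthant, Set.ofPred_forall]
  exact isOpen_iInter_of_finite fun j => isOpen_lt (by fun_prop) (by fun_prop)

lemma posOrthant_subset_nonnegOrthant (m : ℕ) : posOrthant m ⊆ nonnegOrthant m :=
  fun _ hx j => (hx j).le

lemma nonnegOrthant_diff_subset_frontier (m : ℕ) :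
    nonnegOrthant m \ posOrthant m ⊆ frontier (posOrthant m) := by
  rw [(isOpen_posOrthant m).frontier_eq]
  refine Set.sdiff_subset_sdiff_left fun x hx => ?_
  have h : Tendsto (fun c : ℝ => x + c • (WithLp.toLp 2 fun _ => 1 : EuclideanSpace ℝ (Fin m)))
      (𝓝[>] 0) (𝓝 x) := by
    refine (Continuous.tendsto' (by fun_prop) _ _ (by simp)).mono_left nhdsWithin_le_nhds
  refine mem_closure_of_tendsto h ?_
  filter_upwards [self_mem_nhdsWithin] with c hc j
  have := hx j
  have : 0 < c := hc
  simp only [PiLp.add_apply, PiLp.smul_apply, smul_eq_mul]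
  linarith

lemma nonnegOrthant_diff_subset (m : ℕ) :
    nonnegOrthant m \ posOrthant m ⊆ {x | ∃ j, x j = 0} := by
  rintro x ⟨h, h'⟩
  simp only [posOrthant, Set.mem_ofPred_eq, not_forall, not_lt] at h'
  obtain ⟨j, hj⟩ := h'
  exact ⟨j, le_antisymm hj (h j)⟩

lemma isClosed_nonnegOrthant_diff (m : ℕ) : IsClosed (nonnegOrthant m \ posOrthant m) :=
  (isClosed_nonnegOrthant m).sdiff (isOpen_posOrthant m)

lemma frontier_nonnegOrthant_subset (m : ℕ) :
    frontier (nonnegOrthant m) ⊆ {x | ∃ j, x j = 0} := by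
  rw [(isClosed_nonnegOrthant m).frontier_eq]
  refine (Set.sdiff_subset_sdiff_right ?_).trans (nonnegOrthant_diff_subset m)
  exact (isOpen_posOrthant m).subset_interior_iff.2 (posOrthant_subset_nonnegOrthant m)

lemma frontier_nonnegOrthant_diff_subset (m : ℕ) :
    frontier (nonnegOrthant m \ posOrthant m) ⊆ {x | ∃ j, x j = 0} :=
  (isClosed_nonnegOrthant_diff m).frontier_subset.trans (nonnegOrthant_diff_subset m)

section Gaussian

variable {m : ℕ}

/-- A Gaussian vector has no mass on the coordinate hyperplanes `x j = 0`, provided that no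
coordinate has both zero mean and zero variance. -/
lemma multivariateGaussian_exists_eq_zero {a : EuclideanSpace ℝ (Fin m)}
    {R : Matrix (Fin m) (Fin m) ℝ} (hR : R.PosSemidef) (h : ∀ j, |a j| + √(R j j) = 1) :
    multivariateGaussian a R {x | ∃ j, x j = 0} = 0 := by
  rw [Set.ofPred_exists, measure_iUnion_null_iff]
  intro j
  have hmp := measurePreserving_eval_multivariateGaussian (μ := a) hR (i := j)
  have : {x : EuclideanSpace ℝ (Fin m) | x j = 0} = (fun x => x j) ⁻¹' {0} := rfl
  rw [this, hmp.measure_preimage (measurableSet_singleton _).nullMeasurableSet]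
  by_cases hv : (R j j).toNNReal = 0
  · rw [hv, gaussianReal_zero_var, Measure.dirac_apply]
    have h0 : √(R j j) = 0 := Real.sqrt_eq_zero'.2 (Real.toNNReal_eq_zero.1 hv)
    have := h j
    rw [h0, add_zero] at this
    have ha : a j ≠ 0 := fun h => by simp [h] at this
    simp [ha]
  · have := nullSingletonClass_gaussianReal (μ := a j) hv
    exact measure_singleton 0

lemma abs_apply_le_one_of_posSemidef {R : Matrix (Fin m) (Fin m) ℝ} (hR : R.PosSemidef)
    (h : ∀ j, R j j ≤ 1) (i j : Fin m) : |R i j| ≤ 1 := by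
  have hsymm : R j i = R i j := by simpa using congrFun (congrFun hR.1 i) j
  have key (c : ℝ) : 0 ≤ R i i + 2 * c * R i j + c ^ 2 * R j j := by
    have := hR.dotProduct_mulVec_nonneg (Pi.single i 1 + Pi.single j c)
    simp only [star_trivial, Matrix.mulVec_add, add_dotProduct, dotProduct_add,
      Matrix.mulVec_single, single_dotProduct, Pi.smul_apply, Matrix.col_apply,
      MulOpposite.smul_eq_mul_unop, MulOpposite.unop_op] at this
    rw [hsymm] at this
    linarith
  have h1 := key 1
  have h2 := key (-1)
  rw [abs_le]
  constructor <;> linarith [h i, h j]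

lemma isClosed_setOf_matrix_posSemidef :
    IsClosed {R : Matrix (Fin m) (Fin m) ℝ | R.PosSemidef} := by
  have : {R : Matrix (Fin m) (Fin m) ℝ | R.PosSemidef} =
      {R | R.conjTranspose = R} ∩ ⋂ x : Fin m → ℝ, {R | 0 ≤ star x ⬝ᵥ R.mulVec x} := by
    ext R
    simp only [Set.mem_ofPred_eq, Set.mem_inter_iff, Set.mem_iInter]
    exact ⟨fun h => ⟨h.1, h.dotProduct_mulVec_nonneg⟩,
      fun h => Matrix.PosSemidef.of_dotProduct_mulVec_nonneg h.1 h.2⟩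
  rw [this]
  refine (isClosed_eq (by fun_prop) (by fun_prop)).inter (isClosed_iInter fun x => ?_)
  exact isClosed_le (by fun_prop) (by fun_prop)

/-- Gaussian measures depend continuously on their mean and covariance, in the sense of pointwise
convergence of characteristic functions. -/
lemma tendsto_charFun_multivariateGaussian {a : ℕ → EuclideanSpace ℝ (Fin m)}
    {R : ℕ → Matrix (Fin m) (Fin m) ℝ} (hR : ∀ t, (R t).PosSemidef)
    {a₀ : EuclideanSpace ℝ (Fin m)} {R₀ : Matrix (Fin m) (Fin m) ℝ} (hR₀ : R₀.PosSemidef)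
    (ha : Tendsto a atTop (𝓝 a₀)) (hRlim : Tendsto R atTop (𝓝 R₀))
    (s : EuclideanSpace ℝ (Fin m)) :
    Tendsto (fun t => charFun (multivariateGaussian (a t) (R t)) s) atTop
      (𝓝 (charFun (multivariateGaussian a₀ R₀) s)) := by
  simp_rw [fun t => charFun_multivariateGaussian (μ := a t) (hR t) s]
  rw [charFun_multivariateGaussian hR₀]
  have h1 : Tendsto (fun t => inner ℝ s (a t)) atTop (𝓝 (inner ℝ s a₀)) :=
    tendsto_const_nhds.inner ha
  have h2 : Tendsto (fun t => dotProduct s.ofLp ((R t).mulVec s.ofLp)) atTop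
      (𝓝 (dotProduct s.ofLp (R₀.mulVec s.ofLp))) := by
    have hc : Continuous fun Q : Matrix (Fin m) (Fin m) ℝ =>
        dotProduct s.ofLp (Q.mulVec s.ofLp) := by fun_prop
    exact (hc.tendsto R₀).comp hRlim
  have h1' := (Complex.continuous_ofReal.tendsto _).comp h1
  have h2' := (Complex.continuous_ofReal.tendsto _).comp h2
  exact (Complex.continuous_exp.tendsto _).comp
    ((h1'.mul_const Complex.I).sub (h2'.div_const 2))

/-- Comparison with Gaussian measures that need not converge. The normalization
`|a j| + √(R j j) = 1` makes the family of Gaussian measures precompact and keeps every limit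
point from charging the coordinate hyperplanes, so that the portmanteau theorem applies along
subsequences. -/
theorem tendsto_measureReal_sub_multivariateGaussian {ρ : ℕ → Measure (EuclideanSpace ℝ (Fin m))}
    [∀ t, IsProbabilityMeasure (ρ t)] {a : ℕ → EuclideanSpace ℝ (Fin m)}
    {R : ℕ → Matrix (Fin m) (Fin m) ℝ} (hR : ∀ t, (R t).PosSemidef)
    (hnorm : ∀ t j, |a t j| + √(R t j j) = 1)
    (hchar : ∀ s, Tendsto (fun t => charFun (ρ t) s - charFun (multivariateGaussian (a t) (R t)) s)
      atTop (𝓝 0))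
    {A : Set (EuclideanSpace ℝ (Fin m))} (hA : frontier A ⊆ {x | ∃ j, x j = 0}) :
    Tendsto (fun t => (ρ t).real A - (multivariateGaussian (a t) (R t)).real A) atTop (𝓝 0) := by
  refine tendsto_of_subseq_tendsto fun ns hns => ?_
  have hdiag (t j) : R t j j ≤ 1 := by
    have h1 : √(R t j j) ≤ 1 := by linarith [hnorm t j, abs_nonneg (a t j)]
    simpa using h1
  let x : ℕ → (Fin m → ℝ) × (Fin m → Fin m → ℝ) := fun n => ((a (ns n)).ofLp, R (ns n))
  have hx : ∀ n, x n ∈ Metric.closedBall (0 : (Fin m → ℝ) × (Fin m → Fin m → ℝ)) 1 := by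
    intro n
    rw [mem_closedBall_zero_iff]
    refine max_le ((pi_norm_le_iff_of_nonneg zero_le_one).2 fun j => ?_)
      ((pi_norm_le_iff_of_nonneg zero_le_one).2 fun i =>
        (pi_norm_le_iff_of_nonneg zero_le_one).2 fun j => ?_)
    · rw [Real.norm_eq_abs]
      linarith [hnorm (ns n) j, Real.sqrt_nonneg (R (ns n) j j)]
    · exact abs_apply_le_one_of_posSemidef (hR _) (hdiag _) i j
  obtain ⟨a₀, R₀, φ, hφ, ha, hRl⟩ : ∃ (a₀ : EuclideanSpace ℝ (Fin m))
      (R₀ : Matrix (Fin m) (Fin m) ℝ) (φ : ℕ → ℕ), StrictMono φ ∧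
        Tendsto (fun n => a (ns (φ n))) atTop (𝓝 a₀) ∧
        Tendsto (fun n => R (ns (φ n))) atTop (𝓝 R₀) := by
    obtain ⟨⟨a₀, R₀⟩, -, φ, hφ, hlim⟩ := (isCompact_closedBall _ _).tendsto_subseq hx
    exact ⟨WithLp.toLp 2 a₀, R₀, φ, hφ,
      ((PiLp.continuous_toLp 2 _).tendsto a₀).comp ((continuous_fst.tendsto _).comp hlim),
      (continuous_snd.tendsto _).comp hlim⟩
  have hR₀ : R₀.PosSemidef :=
    isClosed_setOf_matrix_posSemidef.mem_of_tendsto hRl (Eventually.of_forall fun _ => hR _)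
  have hnorm₀ : ∀ j, |a₀ j| + √(R₀ j j) = 1 := by
    intro j
    have h1 : Tendsto (fun n => a (ns (φ n)) j) atTop (𝓝 (a₀ j)) :=
      ((EuclideanSpace.proj j).continuous.tendsto a₀).comp ha
    have h2 : Tendsto (fun n => R (ns (φ n)) j j) atTop (𝓝 (R₀ j j)) :=
      ((continuous_id.matrix_elem j j).tendsto R₀).comp hRl
    refine tendsto_nhds_unique (h1.abs.add h2.sqrt) ?_
    exact tendsto_const_nhds.congr fun n => (hnorm _ j).symm
  have hnull : multivariateGaussian a₀ R₀ (frontier A) = 0 :=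
    measure_mono_null hA (multivariateGaussian_exists_eq_zero hR₀ hnorm₀)
  have hG (s) := tendsto_charFun_multivariateGaussian (fun n => hR (ns (φ n))) hR₀ ha hRl s
  have hρ (s) : Tendsto (fun n => charFun (ρ (ns (φ n))) s) atTop
      (𝓝 (charFun (multivariateGaussian a₀ R₀) s)) := by
    have := ((hchar s).comp (hns.comp hφ.tendsto_atTop)).add (hG s)
    simpa using this
  have conv {κ : ℕ → Measure (EuclideanSpace ℝ (Fin m))} [hκ : ∀ t, IsProbabilityMeasure (κ t)]
      (h : ∀ s, Tendsto (fun n => charFun (κ n) s) atTop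
        (𝓝 (charFun (multivariateGaussian a₀ R₀) s))) :
      Tendsto (fun n => (κ n).real A) atTop
        (𝓝 ((multivariateGaussian a₀ R₀).real A)) := by
    have := ProbabilityMeasure.tendsto_of_tendsto_charFun
      (μ := fun n => (⟨κ n, hκ n⟩ : ProbabilityMeasure (EuclideanSpace ℝ (Fin m))))
      (μ₀ := ⟨multivariateGaussian a₀ R₀, inferInstance⟩) h
    exact (ENNReal.tendsto_toReal (measure_ne_top _ _)).comp
      (ProbabilityMeasure.tendsto_measure_of_null_frontier_of_tendsto' this hnull)
  refine ⟨φ, ?_⟩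
  simpa using (conv hρ).sub (conv hG)

end Gaussian

/-! ### Coordinatewise rescaling -/

section Rescaling

variable {m : ℕ}

/-- The coordinatewise affine map `x ↦ (c j * x j + b j)_j` of `ℝᵐ`. -/
def coordAffine (c b : Fin m → ℝ) (x : EuclideanSpace ℝ (Fin m)) : EuclideanSpace ℝ (Fin m) :=
  WithLp.toLp 2 fun j => c j * x j + b j

@[simp]
lemma coordAffine_apply (c b : Fin m → ℝ) (x : EuclideanSpace ℝ (Fin m)) (j : Fin m) :
    coordAffine c b x j = c j * x j + b j := rfl

lemma continuous_coordAffine (c b : Fin m → ℝ) : Continuous (coordAffine c b) := by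
  unfold coordAffine; fun_prop

lemma charFun_map_coordAffine (ρ : Measure (EuclideanSpace ℝ (Fin m))) (c b : Fin m → ℝ)
    (s : EuclideanSpace ℝ (Fin m)) :
    charFun (ρ.map (coordAffine c b)) s =
      Complex.exp ((∑ j, b j * s j : ℝ) * Complex.I) * charFun ρ (coordAffine c 0 s) := by
  rw [charFun_apply, charFun_apply, integral_map (continuous_coordAffine c b).aemeasurable
    (by fun_prop), ← integral_const_mul]
  congr 1 with x
  rw [← Complex.exp_add, ← add_mul, ← Complex.ofReal_add]
  congr 3
  simp only [PiLp.inner_apply, coordAffine_apply, RCLike.inner_apply, conj_trivial, Pi.zero_apply,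
    add_zero]
  rw [← Finset.sum_add_distrib]
  exact Finset.sum_congr rfl fun j _ => by ring

lemma map_coordAffine_multivariateGaussian {a : EuclideanSpace ℝ (Fin m)}
    {Q : Matrix (Fin m) (Fin m) ℝ} (hQ : Q.PosSemidef) (c b : Fin m → ℝ) :
    (multivariateGaussian a Q).map (coordAffine c b) =
      multivariateGaussian (coordAffine c b a) (Matrix.diagonal c * Q * Matrix.diagonal c) := by
  have hQ' : (Matrix.diagonal c * Q * Matrix.diagonal c).PosSemidef := by
    simpa using hQ.conjTranspose_mul_mul_same (Matrix.diagonal c)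
  have := Measure.isProbabilityMeasure_map (μ := multivariateGaussian a Q)
    (continuous_coordAffine c b).aemeasurable
  apply Measure.ext_of_charFun
  ext s
  rw [charFun_map_coordAffine, charFun_multivariateGaussian hQ, charFun_multivariateGaussian hQ',
    ← Complex.exp_add]
  have e1 : (coordAffine c 0 s).ofLp = (Matrix.diagonal c).mulVec s.ofLp := by
    ext j; simp [Matrix.mulVec_diagonal]
  have e2 : dotProduct s.ofLp ((Matrix.diagonal c * Q * Matrix.diagonal c).mulVec s.ofLp) =
      dotProduct (coordAffine c 0 s).ofLp (Q.mulVec (coordAffine c 0 s).ofLp) := by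
    rw [e1, ← Matrix.mulVec_mulVec, ← Matrix.mulVec_mulVec, Matrix.dotProduct_mulVec,
      ← Matrix.mulVec_transpose, Matrix.diagonal_transpose]
  have e3 : (inner ℝ s (coordAffine c b a) : ℝ) =
      ∑ j, b j * s j + inner ℝ (coordAffine c 0 s) a := by
    simp only [PiLp.inner_apply, coordAffine_apply, RCLike.inner_apply, conj_trivial,
      Pi.zero_apply, add_zero]
    rw [← Finset.sum_add_distrib]
    exact Finset.sum_congr rfl fun j _ => by ring
  rw [e2, e3]
  push_cast
  congr 1
  ring

/-- The factors by which the coordinates of a random vector with mean `a` and covariance matrix `Q`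
are multiplied in order that `|mean| + standard deviation = 1` in each coordinate; the factor is `0`
if the mean and the variance of the coordinate both vanish. -/
noncomputable def orthantScale (a : EuclideanSpace ℝ (Fin m)) (Q : Matrix (Fin m) (Fin m) ℝ)
    (j : Fin m) : ℝ := (|a j| + √(Q j j))⁻¹

open Classical in
/-- The shift that moves the coordinates with zero mean and zero variance to the value `1`. -/
noncomputable def orthantShift (a : EuclideanSpace ℝ (Fin m)) (Q : Matrix (Fin m) (Fin m) ℝ)
    (j : Fin m) : ℝ := if |a j| + √(Q j j) = 0 then 1 else 0

variable {a : EuclideanSpace ℝ (Fin m)} {Q : Matrix (Fin m) (Fin m) ℝ}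

lemma orthantScale_nonneg (j : Fin m) : 0 ≤ orthantScale a Q j := by
  unfold orthantScale; positivity

lemma abs_coordAffine_add_sqrt (j : Fin m) :
    |coordAffine (orthantScale a Q) (orthantShift a Q) a j| +
      √((Matrix.diagonal (orthantScale a Q) * Q * Matrix.diagonal (orthantScale a Q)) j j) = 1 := by
  rw [Matrix.mul_diagonal, Matrix.diagonal_mul, mul_comm, ← mul_assoc, ← sq,
    Real.sqrt_mul (sq_nonneg _), Real.sqrt_sq (orthantScale_nonneg j), coordAffine_apply,
    orthantScale, orthantShift]
  split_ifs with h
  · simp [h]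
  · rw [add_zero, abs_mul, abs_inv, abs_of_nonneg (by positivity : 0 ≤ |a j| + √(Q j j)),
      ← mul_add, inv_mul_cancel₀ h]

/-- Where the degenerate coordinates vanish, the rescaling preserves the closed orthant. -/
lemma coordAffine_mem_nonnegOrthant_iff {x : EuclideanSpace ℝ (Fin m)}
    (hx : ∀ j, |a j| + √(Q j j) = 0 → x j = 0) :
    coordAffine (orthantScale a Q) (orthantShift a Q) x ∈ nonnegOrthant m ↔
      x ∈ nonnegOrthant m := by
  refine forall_congr' fun j => ?_
  rw [coordAffine_apply, orthantScale, orthantShift]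
  split_ifs with h
  · simp [hx j h]
  · have : 0 < (|a j| + √(Q j j))⁻¹ := inv_pos.2 (lt_of_le_of_ne (by positivity) (Ne.symm h))
    rw [add_zero, mul_nonneg_iff_of_pos_left this]

lemma coordAffine_mem_posOrthant_iff (h : ∀ j, |a j| + √(Q j j) ≠ 0)
    {x : EuclideanSpace ℝ (Fin m)} :
    coordAffine (orthantScale a Q) (orthantShift a Q) x ∈ posOrthant m ↔ x ∈ posOrthant m := by
  refine forall_congr' fun j => ?_
  rw [coordAffine_apply, orthantScale, orthantShift, if_neg (h j)]
  have : 0 < (|a j| + √(Q j j))⁻¹ := inv_pos.2 (lt_of_le_of_ne (by positivity) (Ne.symm (h j)))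
  rw [add_zero, mul_pos_iff_of_pos_left this]

lemma measureReal_map_coordAffine_nonnegOrthant {ρ : Measure (EuclideanSpace ℝ (Fin m))}
    (hρ : ∀ j, |a j| + √(Q j j) = 0 → ∀ᵐ x ∂ρ, x j = 0) :
    (ρ.map (coordAffine (orthantScale a Q) (orthantShift a Q))).real (nonnegOrthant m) =
      ρ.real (nonnegOrthant m) := by
  rw [map_measureReal_apply (continuous_coordAffine _ _).measurable
    (isClosed_nonnegOrthant m).measurableSet]
  refine measureReal_congr ?_
  have : ∀ᵐ x ∂ρ, ∀ j, |a j| + √(Q j j) = 0 → x j = 0 := by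
    refine ae_all_iff.2 fun j => ?_
    by_cases h : |a j| + √(Q j j) = 0
    · filter_upwards [hρ j h] with x hx _ using hx
    · exact Eventually.of_forall fun x h' => absurd h' h
  filter_upwards [this] with x hx
  exact propext (coordAffine_mem_nonnegOrthant_iff hx)

lemma ae_multivariateGaussian_eq_zero (hQ : Q.PosSemidef) {j : Fin m}
    (h : |a j| + √(Q j j) = 0) : ∀ᵐ x ∂multivariateGaussian a Q, x j = 0 := by
  have ha : a j = 0 := by
    rw [← abs_nonpos_iff]; linarith [Real.sqrt_nonneg (Q j j)]
  have hv : (Q j j).toNNReal = 0 := by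
    rw [Real.toNNReal_eq_zero, ← Real.sqrt_eq_zero']
    simpa [ha] using h
  have hmp := measurePreserving_eval_multivariateGaussian (μ := a) hQ (i := j)
  rw [hv, gaussianReal_zero_var, ha] at hmp
  have : ∀ᵐ y ∂(Measure.dirac (0 : ℝ)), y = 0 := by simp [ae_dirac_eq]
  exact hmp.quasiMeasurePreserving.ae this

end Rescaling

section Orthant

variable {m : ℕ} {ρ : ℕ → Measure (EuclideanSpace ℝ (Fin m))} [∀ t, IsProbabilityMeasure (ρ t)]
  {a : ℕ → EuclideanSpace ℝ (Fin m)} {Q : ℕ → Matrix (Fin m) (Fin m) ℝ}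

/-- Comparison after the rescaling to `|mean| + standard deviation = 1`. -/
lemma tendsto_measureReal_map_coordAffine_sub (hQ : ∀ t, (Q t).PosSemidef)
    (hchar : ∀ s, Tendsto (fun t =>
      charFun (ρ t) (coordAffine (orthantScale (a t) (Q t)) 0 s) -
      charFun (multivariateGaussian (a t) (Q t)) (coordAffine (orthantScale (a t) (Q t)) 0 s))
      atTop (𝓝 0))
    {A : Set (EuclideanSpace ℝ (Fin m))} (hA : frontier A ⊆ {x | ∃ j, x j = 0}) :
    Tendsto (fun t =>
      ((ρ t).map (coordAffine (orthantScale (a t) (Q t)) (orthantShift (a t) (Q t)))).real A -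
      ((multivariateGaussian (a t) (Q t)).map
        (coordAffine (orthantScale (a t) (Q t)) (orthantShift (a t) (Q t)))).real A)
      atTop (𝓝 0) := by
  have hprob (t) : IsProbabilityMeasure
      ((ρ t).map (coordAffine (orthantScale (a t) (Q t)) (orthantShift (a t) (Q t)))) :=
    Measure.isProbabilityMeasure_map (continuous_coordAffine _ _).aemeasurable
  simp_rw [fun t => map_coordAffine_multivariateGaussian (a := a t) (hQ t)]
  refine tendsto_measureReal_sub_multivariateGaussian (fun t => ?_)
    (fun t j => abs_coordAffine_add_sqrt j) (fun s => ?_) hA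
  · simpa using (hQ t).conjTranspose_mul_mul_same (Matrix.diagonal (orthantScale (a t) (Q t)))
  · simp_rw [← fun t => map_coordAffine_multivariateGaussian (a := a t) (hQ t),
      charFun_map_coordAffine, ← mul_sub]
    rw [tendsto_zero_iff_norm_tendsto_zero]
    simp_rw [norm_mul, Complex.norm_exp_ofReal_mul_I, one_mul]
    exact tendsto_zero_iff_norm_tendsto_zero.1 (hchar s)

theorem tendsto_measureReal_nonnegOrthant_sub (hQ : ∀ t, (Q t).PosSemidef)
    (hdeg : ∀ t j, |a t j| + √(Q t j j) = 0 → ∀ᵐ x ∂ρ t, x j = 0)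
    (hchar : ∀ s, Tendsto (fun t =>
      charFun (ρ t) (coordAffine (orthantScale (a t) (Q t)) 0 s) -
      charFun (multivariateGaussian (a t) (Q t)) (coordAffine (orthantScale (a t) (Q t)) 0 s))
      atTop (𝓝 0)) :
    Tendsto (fun t => (ρ t).real (nonnegOrthant m) -
      (multivariateGaussian (a t) (Q t)).real (nonnegOrthant m)) atTop (𝓝 0) := by
  refine (tendsto_measureReal_map_coordAffine_sub hQ hchar
    (frontier_nonnegOrthant_subset m)).congr fun t => ?_
  rw [measureReal_map_coordAffine_nonnegOrthant (hdeg t),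
    measureReal_map_coordAffine_nonnegOrthant fun j => ae_multivariateGaussian_eq_zero (hQ t)]

/-- If the Gaussian measures asymptotically do not charge the boundary of the orthant, then
neither do the measures compared with them. Where every coordinate has nonzero mean or nonzero
variance, the rescaled comparison gives this unconditionally; where some coordinate has neither, all
Gaussian mass of the closed orthant lies on its boundary and the hypothesis takes over. -/
theorem tendsto_measureReal_nonnegOrthant_diff (hQ : ∀ t, (Q t).PosSemidef)
    (hdeg : ∀ t j, |a t j| + √(Q t j j) = 0 → ∀ᵐ x ∂ρ t, x j = 0)
    (hchar : ∀ s, Tendsto (fun t =>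
      charFun (ρ t) (coordAffine (orthantScale (a t) (Q t)) 0 s) -
      charFun (multivariateGaussian (a t) (Q t)) (coordAffine (orthantScale (a t) (Q t)) 0 s))
      atTop (𝓝 0))
    (hfront : Tendsto (fun t => (multivariateGaussian (a t) (Q t)).real
      (frontier (posOrthant m))) atTop (𝓝 0)) :
    Tendsto (fun t => (ρ t).real (nonnegOrthant m \ posOrthant m)) atTop (𝓝 0) := by
  set A := nonnegOrthant m \ posOrthant m with hA
  have h1 := tendsto_measureReal_map_coordAffine_sub hQ hchar
    (frontier_nonnegOrthant_diff_subset m)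
  have h2 := tendsto_measureReal_nonnegOrthant_sub hQ hdeg hchar
  have h3 := (h1.abs.add h2.abs).add hfront
  simp only [abs_zero, add_zero] at h3
  refine squeeze_zero (fun t => measureReal_nonneg) (fun t => ?_) h3
  by_cases hJ : ∀ j, |a t j| + √(Q t j j) ≠ 0
  · have hnull : ((multivariateGaussian (a t) (Q t)).map
        (coordAffine (orthantScale (a t) (Q t)) (orthantShift (a t) (Q t)))).real A = 0 := by
      rw [map_coordAffine_multivariateGaussian (hQ t), measureReal_def,
        measure_mono_null (nonnegOrthant_diff_subset m)
          (multivariateGaussian_exists_eq_zero ?_ fun j => abs_coordAffine_add_sqrt j)]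
      · rfl
      · simpa using (hQ t).conjTranspose_mul_mul_same (Matrix.diagonal (orthantScale (a t) (Q t)))
    have hmap : ((ρ t).map
        (coordAffine (orthantScale (a t) (Q t)) (orthantShift (a t) (Q t)))).real A =
        (ρ t).real A := by
      rw [map_measureReal_apply (continuous_coordAffine _ _).measurable
        (isClosed_nonnegOrthant_diff m).measurableSet]
      congr 1
      ext x
      rw [hA, Set.mem_preimage, Set.mem_sdiff, Set.mem_sdiff, coordAffine_mem_posOrthant_iff hJ,
        coordAffine_mem_nonnegOrthant_iff fun j h => absurd h (hJ j)]
    rw [hnull, hmap, sub_zero]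
    have e1 := le_abs_self ((ρ t).real A)
    have e2 := abs_nonneg ((ρ t).real (nonnegOrthant m) -
      (multivariateGaussian (a t) (Q t)).real (nonnegOrthant m))
    have e3 : 0 ≤ (multivariateGaussian (a t) (Q t)).real (frontier (posOrthant m)) :=
      measureReal_nonneg
    linarith
  · push Not at hJ
    obtain ⟨j, hj⟩ := hJ
    have e1 : (ρ t).real A ≤ (ρ t).real (nonnegOrthant m) :=
      measureReal_mono Set.sdiff_subset
    have e2 : (multivariateGaussian (a t) (Q t)).real (nonnegOrthant m) ≤
        (multivariateGaussian (a t) (Q t)).real (frontier (posOrthant m)) := by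
      refine ENNReal.toReal_mono (measure_ne_top _ _) (measure_mono_ae ?_)
      filter_upwards [ae_multivariateGaussian_eq_zero (hQ t) hj] with x hx hxC
      exact nonnegOrthant_diff_subset_frontier m ⟨hxC, fun hO => (hO j).ne' hx⟩
    have e3 := le_abs_self ((ρ t).real (nonnegOrthant m) -
      (multivariateGaussian (a t) (Q t)).real (nonnegOrthant m))
    have e4 := abs_nonneg (((ρ t).map
        (coordAffine (orthantScale (a t) (Q t)) (orthantShift (a t) (Q t)))).real A -
      ((multivariateGaussian (a t) (Q t)).map
        (coordAffine (orthantScale (a t) (Q t)) (orthantShift (a t) (Q t)))).real A)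
    linarith

end Orthant

/-- The Gaussian distribution function at `0` as an orthant probability of the reflected
Gaussian. -/
lemma gaussianCDF_zero_neg {m : ℕ} (a : EuclideanSpace ℝ (Fin m)) {Q : Matrix (Fin m) (Fin m) ℝ}
    (hQ : Q.PosSemidef) :
    gaussianCDF 0 (-a) Q = (multivariateGaussian a Q).real (nonnegOrthant m) := by
  have e := map_coordAffine_multivariateGaussian (a := a) hQ (fun _ => -1) 0
  have e1 : coordAffine (fun _ => -1) 0 a = -a := by ext j; simp
  have e2 :
      Matrix.diagonal (fun _ : Fin m => (-1 : ℝ)) * Q * Matrix.diagonal (fun _ => -1) = Q := by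
    ext i j; simp [Matrix.mul_diagonal, Matrix.diagonal_mul]
  rw [e1, e2] at e
  rw [gaussianCDF, ← e, map_measureReal_apply (continuous_coordAffine _ _).measurable]
  · congr 1
    ext x
    simp [nonnegOrthant]
  · simp only [Set.ofPred_forall]
    exact (isClosed_iInter fun j => isClosed_le (by fun_prop) (by fun_prop)).measurableSet

/-! ### Margins of a retrieval problem -/

namespace RetrievalProblem

variable {m : ℕ} (I : RetrievalProblem m) {ε : ℝ}

lemma p_nonneg (hε₀ : 0 ≤ ε) (hε₁ : ε ≤ 1) (i : Fin I.N) : 0 ≤ I.p ε i :=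
  sub_nonneg.2 (pow_le_one₀ hε₀ hε₁)

lemma p_le_one (hε₀ : 0 ≤ ε) (i : Fin I.N) : I.p ε i ≤ 1 :=
  sub_le_self _ (pow_nonneg hε₀ _)

lemma p_mul_nonneg (hε₀ : 0 ≤ ε) (hε₁ : ε ≤ 1) (i : Fin I.N) :
    0 ≤ I.p ε i * (1 - I.p ε i) :=
  mul_nonneg (I.p_nonneg hε₀ hε₁ i) (sub_nonneg.2 (I.p_le_one hε₀ i))

lemma posSemidef_covMat (hε₀ : 0 ≤ ε) (hε₁ : ε ≤ 1) : (I.covMat ε).PosSemidef := by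
  refine Matrix.posSemidef_sum _ fun i _ => Matrix.PosSemidef.smul ?_ (I.p_mul_nonneg hε₀ hε₁ i)
  simpa using Matrix.posSemidef_vecMulVec_self_star (I.δ i).ofLp

lemma dirVar_eq_sum (u : EuclideanSpace ℝ (Fin m)) :
    I.dirVar ε u = ∑ i ∈ I.S, I.p ε i * (1 - I.p ε i) * inner ℝ u (I.δ i) ^ 2 := by
  rw [dirVar, covMat, Matrix.sum_mulVec, dotProduct_sum]
  refine Finset.sum_congr rfl fun i _ => ?_
  rw [Matrix.smul_mulVec, dotProduct_smul, Matrix.vecMulVec_mulVec, smul_eq_mul,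
    op_smul_eq_smul, dotProduct_smul, smul_eq_mul, sq]
  congr 1
  simp only [dotProduct, PiLp.inner_apply, RCLike.inner_apply, conj_trivial]
  congr 1
  exact Finset.sum_congr rfl fun j _ => by ring

lemma dirVar_nonneg (hε₀ : 0 ≤ ε) (hε₁ : ε ≤ 1) (u : EuclideanSpace ℝ (Fin m)) :
    0 ≤ I.dirVar ε u := by
  rw [dirVar_eq_sum]
  exact Finset.sum_nonneg fun i _ => mul_nonneg (I.p_mul_nonneg hε₀ hε₁ i) (sq_nonneg _)

lemma inner_single_δ (j : Fin m) (i : Fin I.N) :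
    inner ℝ (EuclideanSpace.single j 1) (I.δ i) = I.δ i j := by
  simp [EuclideanSpace.inner_single_left]

lemma covMat_diag (j : Fin m) :
    I.covMat ε j j = I.dirVar ε (EuclideanSpace.single j 1) := by
  rw [dirVar_eq_sum, covMat, Matrix.sum_apply]
  refine Finset.sum_congr rfl fun i _ => ?_
  rw [inner_single_δ, Matrix.smul_apply, Matrix.vecMulVec_apply, smul_eq_mul, sq]

/-- The numerator of the Lindeberg ratio, written out for Bernoulli variables: the sum of the
truncated second moments of the contributions of the coordinates in direction `w`. -/
noncomputable def truncVar (ε : ℝ) (w : EuclideanSpace ℝ (Fin m)) (η : ℝ) : ℝ :=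
  ∑ i ∈ I.S, centeredBernoulli (I.p ε i) fun x => truncSq η (x * inner ℝ w (I.δ i))

lemma truncVar_nonneg (hε₀ : 0 ≤ ε) (hε₁ : ε ≤ 1) (w : EuclideanSpace ℝ (Fin m)) (η : ℝ) :
    0 ≤ I.truncVar ε w η :=
  Finset.sum_nonneg fun i _ => centeredBernoulli_nonneg (I.p_nonneg hε₀ hε₁ i) (I.p_le_one hε₀ i)
    fun _ => truncSq_nonneg _ _

/-- The vector of the score differences between the competitors and the ground-truth document. -/
noncomputable def margin {Ω : Type*} (e : Fin I.N → Ω → ℝ) (ω : Ω) : EuclideanSpace ℝ (Fin m) :=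
  WithLp.toLp 2 fun j => I.score (I.received e ω) (I.comp j) - I.score (I.received e ω) I.k

lemma margin_eq (ε : ℝ) {Ω : Type*} (e : Fin I.N → Ω → ℝ) (ω : Ω) :
    I.margin e ω = I.μ ε + ∑ i ∈ I.S, I.Y ε e i ω := by
  ext j
  simp only [margin, μ, Y, score, received, PiLp.add_apply, WithLp.ofLp_sum, Finset.sum_apply,
    PiLp.smul_apply, smul_eq_mul, C, δ]
  rw [← Finset.sum_sub_distrib, ← Finset.sum_add_distrib]
  exact Finset.sum_congr rfl fun i _ => by ring

section Erasure

variable {I} {Ω : Type*} [MeasurableSpace Ω] {P : Measure Ω} {e : Fin I.N → Ω → ℝ}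

lemma IsErasure.measurable_margin (he : I.IsErasure ε P e) : Measurable (I.margin e) := by
  have := he.measurable
  simp only [funext (I.margin_eq ε e), Y]
  fun_prop

variable [IsProbabilityMeasure P]

lemma IsErasure.ae_eq_one_or_zero (he : I.IsErasure ε P e) (i : Fin I.N) :
    ∀ᵐ ω ∂P, e i ω = 1 ∨ e i ω = 0 := by
  have hm1 : MeasurableSet {ω | e i ω = 1} := he.measurable i (measurableSet_singleton 1)
  have hm0 : MeasurableSet {ω | e i ω = 0} := he.measurable i (measurableSet_singleton 0)
  have hd : Disjoint {ω | e i ω = 1} {ω | e i ω = 0} := by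
    rw [Set.disjoint_left]
    intro ω (h1 : e i ω = 1) (h0 : e i ω = 0)
    rw [h1] at h0
    exact one_ne_zero h0
  have hu := measureReal_union (μ := P) hd hm0
  rw [he.prob_one, he.prob_zero, sub_add_cancel] at hu
  have hu' : P ({ω | e i ω = 1} ∪ {ω | e i ω = 0}) = 1 := by
    rwa [measureReal_def, ENNReal.toReal_eq_one_iff] at hu
  exact (mem_ae_iff_prob_eq_one (hm1.union hm0)).2 hu'

lemma IsErasure.integral_comp_sub {F : Type*} [NormedAddCommGroup F] [NormedSpace ℝ F]
    [CompleteSpace F] (he : I.IsErasure ε P e) (i : Fin I.N) (f : ℝ → F) :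
    ∫ ω, f (e i ω - I.p ε i) ∂P = centeredBernoulli (I.p ε i) f := by
  have hm1 : MeasurableSet {ω | e i ω = 1} := he.measurable i (measurableSet_singleton 1)
  have hm0 : MeasurableSet {ω | e i ω = 0} := he.measurable i (measurableSet_singleton 0)
  have hae : (fun ω => f (e i ω - I.p ε i)) =ᵐ[P] fun ω =>
      {ω | e i ω = 1}.indicator (fun _ => f (1 - I.p ε i)) ω +
      {ω | e i ω = 0}.indicator (fun _ => f (-I.p ε i)) ω := by
    filter_upwards [he.ae_eq_one_or_zero i] with ω hω
    rcases hω with h | h <;> simp [Set.indicator, h]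
  rw [integral_congr_ae hae, integral_add ((integrable_const _).indicator hm1)
    ((integrable_const _).indicator hm0), integral_indicator_const _ hm1,
    integral_indicator_const _ hm0, he.prob_one, he.prob_zero, centeredBernoulli, p, sub_sub_cancel]

lemma IsErasure.lindebergRatio_eq (he : I.IsErasure ε P e) (u : EuclideanSpace ℝ (Fin m)) (η : ℝ) :
    I.lindebergRatio ε P e u η = I.truncVar ε u (η * √(I.dirVar ε u)) / I.dirVar ε u := by
  rw [lindebergRatio, truncVar]
  congr 1
  refine Finset.sum_congr rfl fun i _ => ?_
  rw [← he.integral_comp_sub i]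
  congr 1 with ω
  simp only [Y, inner_smul_right, truncSq, Set.indicator, Set.mem_ofPred_eq]

lemma IsErasure.charFun_margin (he : I.IsErasure ε P e) (w : EuclideanSpace ℝ (Fin m)) :
    charFun (P.map (I.margin e)) w =
      Complex.exp ((inner ℝ (I.μ ε) w : ℝ) * Complex.I) *
        ∏ i ∈ I.S, centeredBernoulli (I.p ε i) fun x =>
          Complex.exp ((x * inner ℝ w (I.δ i) : ℝ) * Complex.I) := by
  have hY (i) : Measurable (I.Y ε e i) := by
    have := he.measurable i
    unfold Y
    fun_prop
  have hind : iIndepFun (fun i => I.Y ε e i) P :=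
    he.indep.comp (fun i x => (x - I.p ε i) • I.δ i) fun i => by fun_prop
  have hmap : P.map (I.margin e) =
      (P.map fun ω => ∑ i ∈ I.S, I.Y ε e i ω).map (fun x => I.μ ε + x) := by
    rw [Measure.map_map (by fun_prop) (by fun_prop)]
    congr 1
    exact funext (I.margin_eq ε e)
  rw [hmap, charFun_map_const_add, mul_comm,
    iIndepFun.charFun_map_fun_finsetSum_eq_prod (fun i _ => (hY i).aemeasurable)
      (hind.restrict _), Finset.prod_apply]
  congr 1
  refine Finset.prod_congr rfl fun i _ => ?_
  rw [charFun_apply, integral_map (hY i).aemeasurable (by fun_prop), ← he.integral_comp_sub i]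
  congr 1 with ω
  rw [Y, real_inner_comm, inner_smul_right]

/-- Lindeberg's estimate for the characteristic function of the margin vector. -/
lemma IsErasure.norm_charFun_margin_sub_le (hε₀ : 0 ≤ ε) (hε₁ : ε ≤ 1)
    (he : I.IsErasure ε P e) {w : EuclideanSpace ℝ (Fin m)} {η B : ℝ} (hη₀ : 0 ≤ η) (hη₁ : η ≤ 1)
    (hB : I.dirVar ε w ≤ B) :
    ‖charFun (P.map (I.margin e)) w - charFun (multivariateGaussian (I.μ ε) (I.covMat ε)) w‖
      ≤ 2 * η * B + (4 + B) * I.truncVar ε w η := by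
  have hG : charFun (multivariateGaussian (I.μ ε) (I.covMat ε)) w =
      Complex.exp ((inner ℝ (I.μ ε) w : ℝ) * Complex.I) *
        (Real.exp (-(I.dirVar ε w / 2)) : ℝ) := by
    rw [charFun_multivariateGaussian (I.posSemidef_covMat hε₀ hε₁), Complex.ofReal_exp,
      ← Complex.exp_add, real_inner_comm, dirVar]
    push_cast
    rfl
  rw [hG, he.charFun_margin, ← mul_sub, norm_mul, Complex.norm_exp_ofReal_mul_I, one_mul]
  rw [dirVar_eq_sum] at hB ⊢
  exact norm_prod_centeredBernoulli_exp_sub_le I.S (I.p_nonneg hε₀ hε₁) (I.p_le_one hε₀)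
    hη₀ hη₁ hB

/-- Degenerate coordinates of the margin vector vanish almost surely. -/
lemma IsErasure.ae_margin_eq_zero (hε₀ : 0 ≤ ε) (hε₁ : ε ≤ 1) (he : I.IsErasure ε P e) {j : Fin m}
    (h : |I.μ ε j| + √(I.covMat ε j j) = 0) : ∀ᵐ x ∂P.map (I.margin e), x j = 0 := by
  have hμ : I.μ ε j = 0 := by
    rw [← abs_nonpos_iff]; linarith [Real.sqrt_nonneg (I.covMat ε j j)]
  have hv : I.dirVar ε (EuclideanSpace.single j 1) = 0 := by
    refine le_antisymm ?_ (I.dirVar_nonneg hε₀ hε₁ _)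
    rw [← covMat_diag, ← Real.sqrt_eq_zero']
    simpa [hμ] using h
  rw [dirVar_eq_sum, Finset.sum_eq_zero_iff_of_nonneg
    fun i _ => mul_nonneg (I.p_mul_nonneg hε₀ hε₁ i) (sq_nonneg _)] at hv
  have hY : ∀ᵐ ω ∂P, ∀ i, i ∈ I.S → I.Y ε e i ω j = 0 := by
    refine ae_all_iff.2 fun i => ?_
    by_cases hi : i ∈ I.S
    swap
    · exact Eventually.of_forall fun ω h' => absurd h' hi
    have hz := hv i hi
    rw [inner_single_δ] at hz
    have hint := he.integral_comp_sub i fun x => (x * I.δ i j) ^ 2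
    rw [centeredBernoulli_sq, hz] at hint
    have hm := he.measurable i
    have hbdd : Integrable (fun ω => ((e i ω - I.p ε i) * I.δ i j) ^ 2) P := by
      refine Integrable.of_bound (by fun_prop) ((I.δ i j) ^ 2) ?_
      have hp0 := I.p_nonneg hε₀ hε₁ i
      have hp1 := I.p_le_one hε₀ i
      filter_upwards [he.ae_eq_one_or_zero i] with ω hω
      rw [Real.norm_of_nonneg (sq_nonneg _), mul_pow]
      refine mul_le_of_le_one_left (sq_nonneg _) ?_
      rcases hω with h | h <;> rw [h] <;> nlinarith
    have := (integral_eq_zero_iff_of_nonneg (fun ω => sq_nonneg _) hbdd).1 hint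
    filter_upwards [this] with ω hω _
    simpa [Y] using hω
  rw [ae_map_iff he.measurable_margin.aemeasurable
    (measurableSet_eq_fun (by fun_prop) measurable_const)]
  filter_upwards [hY] with ω hω
  rw [I.margin_eq ε, PiLp.add_apply, hμ, WithLp.ofLp_sum, Finset.sum_apply, zero_add]
  exact Finset.sum_eq_zero fun i hi => hω i hi

/-- The minimum-distance rule succeeds if all margins are positive, and only if all margins are
nonnegative, however ties are broken. -/
lemma IsErasure.errorProb_bounds (he : I.IsErasure ε P e) {khat : Ω → Fin (m + 1)}
    (hk : I.IsDecision P e khat) :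
    (P.map (I.margin e)).real (posOrthant m) ≤ 1 - I.errorProb P khat ∧
      1 - I.errorProb P khat ≤ (P.map (I.margin e)).real (nonnegOrthant m) := by
  have hs : MeasurableSet {ω | khat ω = I.k} := hk.measurable (measurableSet_singleton _)
  have herr : 1 - I.errorProb P khat = P.real {ω | khat ω = I.k} := by
    have : {ω | khat ω ≠ I.k} = {ω | khat ω = I.k}ᶜ := rfl
    rw [errorProb, this, probReal_compl_eq_one_sub hs, sub_sub_cancel]
  rw [herr, map_measureReal_apply he.measurable_margin (isOpen_posOrthant m).measurableSet,
    map_measureReal_apply he.measurable_margin (isClosed_nonnegOrthant m).measurableSet]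
  constructor
  · refine ENNReal.toReal_mono (measure_ne_top _ _) (measure_mono_ae ?_)
    filter_upwards [hk.minimizes] with ω hω hpos
    by_contra hne
    obtain ⟨j, hj⟩ := Fin.exists_succAbove_eq (x := khat ω) (y := I.k) hne
    have h1 : 0 < I.margin e ω j := hpos j
    have h2 := hω I.k
    simp only [margin, comp, hj] at h1
    linarith
  · refine ENNReal.toReal_mono (measure_ne_top _ _) (measure_mono_ae ?_)
    filter_upwards [hk.minimizes] with ω hω hkω j
    have hkω' : khat ω = I.k := hkω
    have := hω (I.comp j)
    rw [hkω'] at this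
    simpa [margin] using this

end Erasure

end RetrievalProblem

/-! ### From coordinate directions to rescaled directions -/

namespace RetrievalProblem

variable {m : ℕ} (I : RetrievalProblem m) {ε : ℝ}

lemma inner_coordAffine_δ (c : Fin m → ℝ) (s : EuclideanSpace ℝ (Fin m)) (i : Fin I.N) :
    inner ℝ (coordAffine c 0 s) (I.δ i) = ∑ j, c j * s j * I.δ i j := by
  simp only [PiLp.inner_apply, coordAffine_apply, RCLike.inner_apply, conj_trivial, Pi.zero_apply,
    add_zero]
  exact Finset.sum_congr rfl fun j _ => by ring

lemma orthantScale_mul_sqrt_dirVar_le_one (j : Fin m) :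
    orthantScale (I.μ ε) (I.covMat ε) j * √(I.dirVar ε (EuclideanSpace.single j 1)) ≤ 1 := by
  rw [← covMat_diag, orthantScale, inv_mul_eq_div]
  exact div_le_one_of_le₀ (le_add_of_nonneg_left (abs_nonneg _)) (by positivity)

lemma dirVar_coordAffine_le (hε₀ : 0 ≤ ε) (hε₁ : ε ≤ 1) (s : EuclideanSpace ℝ (Fin m)) :
    I.dirVar ε (coordAffine (orthantScale (I.μ ε) (I.covMat ε)) 0 s) ≤ m * ∑ j, s j ^ 2 := by
  set c := orthantScale (I.μ ε) (I.covMat ε) with hc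
  calc I.dirVar ε (coordAffine c 0 s)
      ≤ ∑ i ∈ I.S, I.p ε i * (1 - I.p ε i) * (m * ∑ j, (c j * s j * I.δ i j) ^ 2) := by
        rw [dirVar_eq_sum]
        refine Finset.sum_le_sum fun i _ => ?_
        refine mul_le_mul_of_nonneg_left ?_ (I.p_mul_nonneg hε₀ hε₁ i)
        rw [inner_coordAffine_δ]
        simpa using sq_sum_le_card_mul_sum_sq (s := Finset.univ)
          (f := fun j => c j * s j * I.δ i j)
    _ = m * ∑ j, s j ^ 2 * (c j * √(I.dirVar ε (EuclideanSpace.single j 1))) ^ 2 := by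
        simp_rw [mul_pow, Real.sq_sqrt (I.dirVar_nonneg hε₀ hε₁ _), dirVar_eq_sum,
          inner_single_δ, Finset.mul_sum]
        rw [Finset.sum_comm]
        exact Finset.sum_congr rfl fun j _ => Finset.sum_congr rfl fun i _ => by ring
    _ ≤ m * ∑ j, s j ^ 2 := by
        gcongr with j
        refine mul_le_of_le_one_right (sq_nonneg _) (pow_le_one₀ ?_ ?_)
        · exact mul_nonneg (orthantScale_nonneg j) (Real.sqrt_nonneg _)
        · exact I.orthantScale_mul_sqrt_dirVar_le_one j

/-- The truncated variance in a rescaled direction is controlled by the Lindeberg ratios in the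
coordinate directions. The rescaled direction varies with the problem, so the Lindeberg condition
for fixed directions does not apply to it directly. -/
lemma truncVar_coordAffine_le (hε₀ : 0 ≤ ε) (hε₁ : ε ≤ 1) (s : EuclideanSpace ℝ (Fin m)) (η : ℝ) :
    I.truncVar ε (coordAffine (orthantScale (I.μ ε) (I.covMat ε)) 0 s) η ≤
      (m : ℝ) ^ 2 * ∑ j, s j ^ 2 * (I.truncVar ε (EuclideanSpace.single j 1)
        (η / m / (|s j| + 1) * √(I.dirVar ε (EuclideanSpace.single j 1))) /
          I.dirVar ε (EuclideanSpace.single j 1)) := by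
  set c := orthantScale (I.μ ε) (I.covMat ε) with hc
  have hmono {i} {f g : ℝ → ℝ} (h : ∀ x, f x ≤ g x) :=
    centeredBernoulli_mono (I.p_nonneg hε₀ hε₁ i) (I.p_le_one hε₀ i) h
  calc I.truncVar ε (coordAffine c 0 s) η
      ≤ ∑ i ∈ I.S, (m : ℝ) ^ 2 * ∑ j, centeredBernoulli (I.p ε i)
          fun x => truncSq (η / m) (c j * s j * (x * I.δ i j)) := by
        refine Finset.sum_le_sum fun i _ => ?_
        rw [← centeredBernoulli_sum, ← centeredBernoulli_const_mul]
        refine hmono fun x => ?_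
        rw [inner_coordAffine_δ, Finset.mul_sum]
        refine (truncSq_sum_le η _).trans_eq ?_
        congr 1
        refine Finset.sum_congr rfl fun j _ => ?_
        congr 1
        ring
    _ = (m : ℝ) ^ 2 * ∑ j, ∑ i ∈ I.S, centeredBernoulli (I.p ε i)
          fun x => truncSq (η / m) (c j * s j * (x * I.δ i j)) := by
        rw [← Finset.mul_sum, Finset.sum_comm]
    _ ≤ _ := by
        refine mul_le_mul_of_nonneg_left (Finset.sum_le_sum fun j _ => ?_) (by positivity)
        set V := I.dirVar ε (EuclideanSpace.single j 1) with hV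
        have hV0 : 0 ≤ V := I.dirVar_nonneg hε₀ hε₁ _
        rcases hV0.eq_or_lt with h0 | hpos
        · rw [← h0, div_zero, mul_zero]
          refine Finset.sum_nonpos fun i hi => ?_
          rw [← h0, dirVar_eq_sum] at hV
          have hz := (Finset.sum_eq_zero_iff_of_nonneg fun i _ =>
            mul_nonneg (I.p_mul_nonneg hε₀ hε₁ i) (sq_nonneg _)).1 hV.symm i hi
          rw [inner_single_δ] at hz
          refine (hmono fun x => truncSq_le_sq _ _).trans_eq ?_
          have e (x : ℝ) : (c j * s j * (x * I.δ i j)) ^ 2 =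
              (c j * s j) ^ 2 * (x * I.δ i j) ^ 2 := by ring
          simp_rw [e]
          rw [centeredBernoulli_const_mul, centeredBernoulli_sq, hz, mul_zero]
        · have hσ : 0 < √V := Real.sqrt_pos.2 hpos
          have hcs : |c j * s j| * √V ≤ |s j| := by
            rw [abs_mul, abs_of_nonneg (orthantScale_nonneg j), mul_right_comm]
            exact mul_le_of_le_one_left (abs_nonneg _) (I.orthantScale_mul_sqrt_dirVar_le_one j)
          rw [mul_div_assoc', mul_div_right_comm, truncVar, Finset.mul_sum]
          refine Finset.sum_le_sum fun i _ => ?_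
          rw [← centeredBernoulli_const_mul, inner_single_δ]
          refine hmono fun x => (truncSq_mul_le hσ hcs _).trans_eq ?_
          rw [Real.sq_sqrt hV0]

end RetrievalProblem

section Sequences

variable {m : ℕ} {ε : ℝ} {I : ℕ → RetrievalProblem m} {Ω : ℕ → Type*}
  [∀ t, MeasurableSpace (Ω t)] {P : ∀ t, Measure (Ω t)} [∀ t, IsProbabilityMeasure (P t)]
  {e : ∀ t, Fin (I t).N → Ω t → ℝ}

/-- The multivariate Lindeberg central limit theorem for the rescaled margins. -/
theorem DirectionalLindeberg.tendsto_charFun_sub (hε₀ : 0 ≤ ε) (hε₁ : ε ≤ 1)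
    (he : ∀ t, (I t).IsErasure ε (P t) (e t)) (hL : DirectionalLindeberg ε I P e)
    (s : EuclideanSpace ℝ (Fin m)) :
    Tendsto (fun t =>
      charFun ((P t).map ((I t).margin (e t)))
        (coordAffine (orthantScale ((I t).μ ε) ((I t).covMat ε)) 0 s) -
      charFun (multivariateGaussian ((I t).μ ε) ((I t).covMat ε))
        (coordAffine (orthantScale ((I t).μ ε) ((I t).covMat ε)) 0 s)) atTop (𝓝 0) := by
  set B : ℝ := m * ∑ j, s j ^ 2 with hB
  have hB0 : 0 ≤ B := by positivity
  rw [Metric.tendsto_nhds]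
  intro κ hκ
  simp only [dist_zero_right]
  -- `η` is small enough to make the untruncated part `2 * η * B` of the estimate at most `κ / 2`
  set η : ℝ := min 1 (κ / (4 * (B + 1))) with hη
  have hη0 : 0 < η := lt_min one_pos (by positivity)
  have hη1 : η ≤ 1 := min_le_left _ _
  have hηB : 2 * η * B ≤ κ / 2 := by
    have h1 : η * (4 * (B + 1)) ≤ κ :=
      (le_div_iff₀ (by positivity)).1 (min_le_right 1 (κ / (4 * (B + 1))))
    nlinarith
  have hlim : Tendsto (fun t => (4 + B) * ((m : ℝ) ^ 2 * ∑ j, s j ^ 2 *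
      (I t).lindebergRatio ε (P t) (e t) (EuclideanSpace.single j 1) (η / m / (|s j| + 1))))
      atTop (𝓝 0) := by
    have : Tendsto (fun t => ∑ j, s j ^ 2 * (I t).lindebergRatio ε (P t) (e t)
        (EuclideanSpace.single j 1) (η / m / (|s j| + 1))) atTop (𝓝 (∑ j, s j ^ 2 * 0)) := by
      refine tendsto_finsetSum _ fun j _ => (hL _ (by simp) _ ?_).const_mul _
      have : (0 : ℝ) < m := by exact_mod_cast j.pos
      positivity
    simpa using (this.const_mul ((m : ℝ) ^ 2)).const_mul (4 + B)
  filter_upwards [hlim.eventually_lt_const (half_pos hκ)] with t ht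
  have h1 := (he t).norm_charFun_margin_sub_le hε₀ hε₁ hη0.le hη1
    ((I t).dirVar_coordAffine_le hε₀ hε₁ s)
  have h2 := (I t).truncVar_coordAffine_le hε₀ hε₁ s η
  simp_rw [← (he t).lindebergRatio_eq] at h2
  have h3 := mul_le_mul_of_nonneg_left h2 (by positivity : 0 ≤ 4 + B)
  linarith

/-- Under the Lindeberg condition the error probability is asymptotically Gaussian. -/
theorem DirectionalLindeberg.tendsto_errorProb_sub (hε₀ : 0 ≤ ε) (hε₁ : ε ≤ 1)
    (he : ∀ t, (I t).IsErasure ε (P t) (e t)) (hL : DirectionalLindeberg ε I P e)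
    {khat : ∀ t, Ω t → Fin (m + 1)} (hk : ∀ t, (I t).IsDecision (P t) (e t) (khat t))
    (hfront : Tendsto (fun t => (multivariateGaussian ((I t).μ ε) ((I t).covMat ε)).real
      (frontier (posOrthant m))) atTop (𝓝 0)) :
    Tendsto (fun t => (I t).errorProb (P t) (khat t) -
      (1 - gaussianCDF 0 (-(I t).μ ε) ((I t).covMat ε))) atTop (𝓝 0) := by
  have hQ (t) := (I t).posSemidef_covMat hε₀ hε₁
  have hprob (t) : IsProbabilityMeasure ((P t).map ((I t).margin (e t))) :=
    Measure.isProbabilityMeasure_map (he t).measurable_margin.aemeasurable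
  have hdeg (t) (j) (h) := (he t).ae_margin_eq_zero hε₀ hε₁ (j := j) h
  have h1 := tendsto_measureReal_nonnegOrthant_sub hQ hdeg (hL.tendsto_charFun_sub hε₀ hε₁ he)
  have h2 := tendsto_measureReal_nonnegOrthant_diff hQ hdeg
    (hL.tendsto_charFun_sub hε₀ hε₁ he) hfront
  simp_rw [fun t => gaussianCDF_zero_neg ((I t).μ ε) (hQ t)]
  refine tendsto_of_tendsto_of_tendsto_of_le_of_le (by simpa using h1.neg)
    (by simpa using h1.neg.add h2) (fun t => ?_) fun t => ?_
  · have := ((he t).errorProb_bounds (hk t)).2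
    simp only
    linarith
  · have h3 := ((he t).errorProb_bounds (hk t)).1
    have h4 := measureReal_sdiff (μ := (P t).map ((I t).margin (e t)))
      (posOrthant_subset_nonnegOrthant m) (isOpen_posOrthant m).measurableSet
    simp only
    linarith

end Sequences

/-! ### Sufficient conditions for the Lindeberg condition -/

namespace RetrievalProblem

variable {m : ℕ} (I : RetrievalProblem m) {ε : ℝ}

lemma v_nonneg (i : Fin I.N) : 0 ≤ I.v i := by
  unfold v; split_ifs <;> positivity

lemma v_pos_of_mem_S {i : Fin I.N} (hi : i ∈ I.S) : 0 < I.v i :=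
  lt_of_le_of_ne (I.v_nonneg i) (Ne.symm (Finset.mem_filter.1 hi).2)

lemma r_pos_of_mem_S {i : Fin I.N} (hi : i ∈ I.S) : 0 < I.r i := by
  have hv := I.v_pos_of_mem_S hi
  have hi' : i ∉ I.stopWords := fun h => by simp [v, h] at hv
  have hcount : 0 < I.count i := by
    rw [Nat.pos_iff_ne_zero]
    intro h
    simp [v, h] at hv
  obtain ⟨l, hl⟩ := Finset.card_pos.1 hcount
  have hM : 0 < I.M := Finset.card_pos.2
    ⟨l, by simpa [(Finset.mem_filter.1 hl).2] using hi'⟩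
  have hM' : (0 : ℝ) < I.M := by exact_mod_cast hM
  have hsum : 0 < ∑ j, I.v j :=
    Finset.sum_pos' (fun j _ => I.v_nonneg j) ⟨i, Finset.mem_univ _, hv⟩
  have := I.R_pos
  exact Nat.ceil_pos.2 (by positivity)

lemma ζ_nonneg (i : Fin I.N) : 0 ≤ I.ζ i := by
  have h : I.docFreq i ≤ m + 1 := (Finset.card_filter_le _ _).trans_eq (by simp)
  have h' : (I.docFreq i : ℝ) ≤ (m + 1 : ℕ) := by exact_mod_cast h
  refine Real.log_nonneg ((one_le_div (by positivity)).2 ?_)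
  linarith

lemma le_p_mul_of_mem_good (hε₀ : 0 ≤ ε) (hε₁ : ε ≤ 1) {r₀ : ℕ} {i : Fin I.N}
    (hi : i ∈ I.good r₀) : ε ^ r₀ * (1 - ε) ≤ I.p ε i * (1 - I.p ε i) := by
  obtain ⟨hS, hr⟩ := Finset.mem_filter.1 hi
  have h1 : ε ^ I.r i ≤ ε := pow_le_of_le_one hε₀ hε₁ (I.r_pos_of_mem_S hS).ne'
  have h2 : ε ^ r₀ ≤ ε ^ I.r i := pow_le_pow_of_le_one hε₀ hε₁ hr
  rw [p, sub_sub_cancel, mul_comm (1 - _)]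
  exact mul_le_mul h2 (by linarith) (by linarith) (by positivity)

lemma abs_inner_δ_le {u : EuclideanSpace ℝ (Fin m)} (hu : ‖u‖ = 1) {i : Fin I.N} {Cd Cζ : ℝ}
    (hd : ∀ j, |I.doc I.k i - I.doc (I.comp j) i| ≤ Cd) (hζ : I.ζ i ≤ Cζ) :
    |inner ℝ u (I.δ i)| ≤ m * (2 * Cζ ^ 2 * |Cd|) * I.v i := by
  have hv := I.v_nonneg i
  have hζ2 : I.ζ i ^ 2 ≤ Cζ ^ 2 := pow_le_pow_left₀ (I.ζ_nonneg i) hζ 2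
  have key (j : Fin m) : |u j * I.δ i j| ≤ 2 * Cζ ^ 2 * |Cd| * I.v i := by
    have huj : |u j| ≤ 1 := by
      rw [← hu, ← Real.norm_eq_abs]; exact PiLp.norm_apply_le u j
    have hδ : |I.δ i j| = 2 * I.ζ i ^ 2 * |I.doc I.k i - I.doc (I.comp j) i| * I.v i := by
      simp only [δ, abs_mul, abs_of_nonneg hv, abs_of_nonneg (sq_nonneg (I.ζ i))]
      rw [abs_two]; ring
    calc |u j * I.δ i j| ≤ |I.δ i j| := by
          rw [abs_mul]; exact mul_le_of_le_one_left (abs_nonneg _) huj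
      _ ≤ _ := by
          rw [hδ]
          have hdj := (hd j).trans (le_abs_self Cd)
          gcongr
  calc |inner ℝ u (I.δ i)| = |∑ j, u j * I.δ i j| := by
        simp only [PiLp.inner_apply, RCLike.inner_apply, conj_trivial, mul_comm]
    _ ≤ ∑ j, |u j * I.δ i j| := Finset.abs_sum_le_sum_abs _ _
    _ ≤ ∑ _j : Fin m, 2 * Cζ ^ 2 * |Cd| * I.v i := Finset.sum_le_sum fun j _ => key j
    _ = _ := by simp; ring

lemma sum_S_eq_good_add_bad (r₀ : ℕ) (f : Fin I.N → ℝ) :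
    ∑ i ∈ I.S, f i = ∑ i ∈ I.good r₀, f i + ∑ i ∈ I.bad r₀, f i := by
  rw [good, bad, ← Finset.sum_filter_add_sum_filter_not I.S (fun i => I.r i ≤ r₀)]
  simp only [not_le]

/-- Only the coordinates with many repetitions contribute to the truncated variance, once those
with few repetitions are numerous enough to make each of them negligible. -/
lemma truncVar_div_le {r₀ : ℕ} (hε₀ : 0 < ε) (hε₁ : ε < 1) {u : EuclideanSpace ℝ (Fin m)}
    {c₁ c₂ c D η : ℝ} (hc₁ : 0 < c₁) (hc : 0 < c) (hη : 0 < η)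
    (hδ : ∀ i ∈ I.S, |inner ℝ u (I.δ i)| ≤ D * I.v i)
    (hv : ∀ i ∈ I.good r₀, c₁ / (I.L : ℝ) ≤ I.v i ∧ I.v i ≤ c₂ / (I.L : ℝ))
    (hnd : c * ∑ i ∈ I.good r₀, I.v i ^ 2 ≤ ∑ i ∈ I.good r₀, inner ℝ u (I.δ i) ^ 2)
    (hcard₀ : 0 < (I.good r₀).card)
    (hcard : D ^ 2 * c₂ ^ 2 ≤ η ^ 2 * (ε ^ r₀ * (1 - ε) * c) * c₁ ^ 2 * (I.good r₀).card) :
    I.truncVar ε u (η * √(I.dirVar ε u)) / I.dirVar ε u ≤ D ^ 2 / (ε ^ r₀ * (1 - ε) * c) *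
      ((∑ i ∈ I.bad r₀, I.v i ^ 2) / ∑ i ∈ I.good r₀, I.v i ^ 2) := by
  set κ := ε ^ r₀ * (1 - ε) * c with hκ
  set EG := ∑ i ∈ I.good r₀, I.v i ^ 2 with hEG
  set V := I.dirVar ε u with hV
  have hκ' : 0 < ε ^ r₀ * (1 - ε) := mul_pos (by positivity) (by linarith)
  have hκ0 : 0 < κ := mul_pos hκ' hc
  have hsub : ∀ i ∈ I.good r₀, i ∈ I.S := fun i hi => (Finset.mem_filter.1 hi).1
  have hEG0 : 0 < EG := Finset.sum_pos (fun i hi => pow_pos (I.v_pos_of_mem_S (hsub i hi)) 2)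
    (Finset.card_pos.1 hcard₀)
  have hVG : κ * EG ≤ V := by
    calc κ * EG ≤ ε ^ r₀ * (1 - ε) * ∑ i ∈ I.good r₀, inner ℝ u (I.δ i) ^ 2 := by
          rw [hκ, mul_assoc]; gcongr
      _ ≤ ∑ i ∈ I.good r₀, I.p ε i * (1 - I.p ε i) * inner ℝ u (I.δ i) ^ 2 := by
          rw [Finset.mul_sum]
          exact Finset.sum_le_sum fun i hi => mul_le_mul_of_nonneg_right
            (I.le_p_mul_of_mem_good hε₀.le hε₁.le hi) (sq_nonneg _)
      _ ≤ V := by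
          rw [hV, dirVar_eq_sum]
          exact Finset.sum_le_sum_of_subset_of_nonneg hsub fun i _ _ =>
            mul_nonneg (I.p_mul_nonneg hε₀.le hε₁.le i) (sq_nonneg _)
  have hV0 : 0 < V := (mul_pos hκ0 hEG0).trans_le hVG
  have hEGcard : (I.good r₀).card * (c₁ / (I.L : ℝ)) ^ 2 ≤ EG := by
    rw [← nsmul_eq_mul]
    exact Finset.card_nsmul_le_sum _ _ _ fun i hi =>
      pow_le_pow_left₀ (by positivity) (hv i hi).1 2
  have hgood : ∀ i ∈ I.good r₀,
      centeredBernoulli (I.p ε i) (fun x => truncSq (η * √V) (x * inner ℝ u (I.δ i))) = 0 := by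
    intro i hi
    refine centeredBernoulli_truncSq_eq_zero (I.p_nonneg hε₀.le hε₁.le i) (I.p_le_one hε₀.le i) ?_
    refine abs_le_of_sq_le_sq ?_ (by positivity)
    rw [mul_pow, Real.sq_sqrt hV0.le]
    calc inner ℝ u (I.δ i) ^ 2 = |inner ℝ u (I.δ i)| ^ 2 := (sq_abs _).symm
      _ ≤ (D * I.v i) ^ 2 := pow_le_pow_left₀ (abs_nonneg _) (hδ i (hsub i hi)) 2
      _ = D ^ 2 * I.v i ^ 2 := by ring
      _ ≤ D ^ 2 * (c₂ / (I.L : ℝ)) ^ 2 := by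
          gcongr
          · exact I.v_nonneg i
          · exact (hv i hi).2
      _ = D ^ 2 * c₂ ^ 2 * (1 / (I.L : ℝ)) ^ 2 := by ring
      _ ≤ η ^ 2 * κ * c₁ ^ 2 * (I.good r₀).card * (1 / (I.L : ℝ)) ^ 2 := by gcongr
      _ = η ^ 2 * (κ * ((I.good r₀).card * (c₁ / (I.L : ℝ)) ^ 2)) := by ring
      _ ≤ η ^ 2 * (κ * EG) := by gcongr
      _ ≤ η ^ 2 * V := by gcongr
  have hbad : ∀ i ∈ I.bad r₀, centeredBernoulli (I.p ε i)
      (fun x => truncSq (η * √V) (x * inner ℝ u (I.δ i))) ≤ D ^ 2 * I.v i ^ 2 := by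
    intro i hi
    have hp0 := I.p_nonneg hε₀.le hε₁.le i
    have hp1 := I.p_le_one hε₀.le i
    calc _ ≤ I.p ε i * (1 - I.p ε i) * inner ℝ u (I.δ i) ^ 2 := by
          rw [← centeredBernoulli_sq]
          exact centeredBernoulli_mono hp0 hp1 fun x => truncSq_le_sq _ _
      _ ≤ inner ℝ u (I.δ i) ^ 2 := mul_le_of_le_one_left (sq_nonneg _) (by nlinarith)
      _ = |inner ℝ u (I.δ i)| ^ 2 := (sq_abs _).symm
      _ ≤ (D * I.v i) ^ 2 :=
          pow_le_pow_left₀ (abs_nonneg _) (hδ i (Finset.mem_filter.1 hi).1) 2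
      _ = D ^ 2 * I.v i ^ 2 := by ring
  calc I.truncVar ε u (η * √V) / V
      ≤ (∑ i ∈ I.bad r₀, D ^ 2 * I.v i ^ 2) / (κ * EG) := by
        refine div_le_div₀ (Finset.sum_nonneg fun i _ => by positivity) ?_ (by positivity) hVG
        · rw [truncVar, I.sum_S_eq_good_add_bad r₀, Finset.sum_eq_zero hgood, zero_add]
          exact Finset.sum_le_sum hbad
    _ = _ := by rw [← Finset.mul_sum, mul_div_mul_comm]

end RetrievalProblem

theorem Regularity.directionalLindeberg {m : ℕ} {ε : ℝ} (hε₀ : 0 < ε) (hε₁ : ε < 1)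
    {I : ℕ → RetrievalProblem m} {Ω : ℕ → Type*} [∀ t, MeasurableSpace (Ω t)]
    {P : ∀ t, Measure (Ω t)} [∀ t, IsProbabilityMeasure (P t)]
    {e : ∀ t, Fin (I t).N → Ω t → ℝ} (he : ∀ t, (I t).IsErasure ε (P t) (e t)) {r₀ : ℕ}
    (h : Regularity r₀ I) : DirectionalLindeberg ε I P e := by
  intro u hu η hη
  obtain ⟨c₁, c₂, hc₁, -, hv⟩ := h.singleton
  obtain ⟨Cd, Cζ, hbdd⟩ := h.bounded
  obtain ⟨c, hc, hnd⟩ := h.nondegenerate u hu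
  set D : ℝ := m * (2 * Cζ ^ 2 * |Cd|) with hD
  have hκ0 : 0 < ε ^ r₀ * (1 - ε) * c :=
    mul_pos (mul_pos (by positivity) (by linarith)) hc
  have hlim := h.tail.const_mul (D ^ 2 / (ε ^ r₀ * (1 - ε) * c))
  rw [mul_zero] at hlim
  have hcard : Tendsto (fun t => η ^ 2 * (ε ^ r₀ * (1 - ε) * c) * c₁ ^ 2 *
      (((I t).good r₀).card : ℝ)) atTop atTop :=
    (tendsto_natCast_atTop_atTop.comp h.card_good).const_mul_atTop (by positivity)
  simp_rw [fun t => (he t).lindebergRatio_eq]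
  refine squeeze_zero' (Eventually.of_forall fun t => ?_) ?_ hlim
  · exact div_nonneg ((I t).truncVar_nonneg hε₀.le hε₁.le _ _)
      ((I t).dirVar_nonneg hε₀.le hε₁.le _)
  · filter_upwards [hv, hnd, hcard.eventually_ge_atTop (D ^ 2 * c₂ ^ 2),
      h.card_good.eventually_gt_atTop 0] with t hvt hndt hct hc0
    exact (I t).truncVar_div_le hε₀ hε₁ hc₁ hc hη
      (fun i hi => (I t).abs_inner_δ_le hu (hbdd t i hi).1 (hbdd t i hi).2) hvt hndt hc0 hct

theorem theorem1 {m : ℕ} (ε : ℝ) (hε₀ : 0 ≤ ε) (hε₁ : ε ≤ 1)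
    (I : ℕ → RetrievalProblem m)
    (hK : Tendsto (fun t => (I t).K) atTop atTop)
    {Ω : ℕ → Type*} [∀ t, MeasurableSpace (Ω t)]
    (P : ∀ t, Measure (Ω t)) [∀ t, IsProbabilityMeasure (P t)]
    (e : ∀ t, Fin (I t).N → Ω t → ℝ)
    (he : ∀ t, (I t).IsErasure ε (P t) (e t))
    (khat : ∀ t, Ω t → Fin (m + 1))
    (hkhat : ∀ t, (I t).IsDecision (P t) (e t) (khat t)) :
    (∀ r₀ : ℕ, 1 ≤ r₀ → 0 < ε → ε < 1 → Regularity r₀ I →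
      DirectionalLindeberg ε I P e) ∧
    (DirectionalLindeberg ε I P e →
      Tendsto (fun t => (multivariateGaussian ((I t).μ ε) ((I t).covMat ε)).real
        (frontier (posOrthant m))) atTop (𝓝 0) →
      Tendsto (fun t => (I t).errorProb (P t) (khat t) -
        (1 - gaussianCDF 0 (-(I t).μ ε) ((I t).covMat ε))) atTop (𝓝 0)) := by
  exact ⟨fun _ _ h0 h1 hreg => hreg.directionalLindeberg h0 h1 he,
    fun hL hfront => hL.tendsto_errorProb_sub hε₀ hε₁ he hkhat hfront⟩
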